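/- **Theorem 4.6.** Let $K$ be a commutative ring, $A$ a commutative $K$-algebra and $(A,U)$ a cocommutative right Hopf algebroid. This means the following. $U$ is a $K$-algebra with a $K$-algebra map $\mathsf s:A\to U$ (the source, which by cocommutativity is equal to the target; its image need not be central). With the $A$-module structure $a\cdot u=u\,\mathsf s(a)$, $U$ is a cocommutative $A$-coalgebra $(U,\Delta,\varepsilon)$, $\Delta(u)=u_1\otimes_A u_2$, such that for all $a\in A$ and $u,v\in U$ $$\mathsf s(a)u_1\otimes u_2=u_1\otimes \mathsf s(a)u_2,\quad \Delta(1)=1\otimes 1,\quad \Delta(uv)=u_1v_1\otimes u_2v_2,\quad \varepsilon(1)=1,\quad \varepsilon(uv)=\varepsilon(\mathsf s(\varepsilon(u))v),$$ and the map $\beta: x\otimes u\mapsto xu_1\otimes u_2$ from $U\otimes_A U$, balanced by $x\,\mathsf s(a)\otimes u=x\otimes \mathsf s(a)u$, to the tensor product $U\otimes_A U$ of $A$-modules is bijective. Let $\mathcal A_U$ be the category of $A$-profinite right $U$-modules, that is, of right $U$-modules whose underlying $A$-module (through $\mathsf s$) is finitely generated and projective. It is symmetric monoidal for $P\otimes_A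 Q$ with $(p\otimes q)u=pu_1\otimes qu_2$, the unit object $A$ with $a\cdot u=\varepsilon(\mathsf s(a)u)$, and the flip as symmetry. For $P$ in $\mathcal A_U$ put $P^*=\mathrm{Hom}_A(P,A)$ and $T_P=\mathrm{End}(P_U)$; in particular $$T_A=\{a\in A\mid a\,\varepsilon(u)=\varepsilon(\mathsf s(a)u)\text{ for all }u\in U\}.$$ The finite dual $U^\circ$ is the quotient of $\bigoplus_{P\in\mathcal A_U}P^*\otimes_{T_P}P$ by the relations $q^*\otimes t(p)=q^*t\otimes p$ for all morphisms $t:P\to Q$ of $\mathcal A_U$, all $q^*\in Q^*$ and $p\in P$. Write $\overline{p^*\otimes p}$ for the class of $p^*\otimes p$. It carries the multiplication $$\overline{p^*\otimes p}\;\overline{q^*\otimes q}=\overline{(q^*\star p^*)\otimes(q\otimes_A p)},\qquad (q^*\star p^*)(y\otimes x)=q^*(y)\,p^*(x),$$ with unit $\overline{\mathrm{id}_A\otimes 1}$, the source $\mathsf s^\circ(a)=\overline{l_a\otimes 1}$, where $l_a(x)=ax$ on $A$, and the target $\mathsf t^\circ(a)=\overline{\mathrm{id}_A\otimes a}$. It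 is an $A$-bimodule by $a\cdot h\cdot b=\mathsf s^\circ(a)\,h\,\mathsf t^\circ(b)$. Let $\zeta:U^\circ\to U^*=\mathrm{Hom}_A(U,A)$ be the map $\overline{p^*\otimes p}\mapsto[u\mapsto p^*(pu)]$. Then: 1. $(A,U^\circ)$ is a commutative Hopf algebroid over $T_A$, with the above multiplication, source and target, with the comultiplication and the counit $$\Delta^\circ(\overline{p^*\otimes p})=\sum_i\overline{p^*\otimes e_i}\otimes_A\overline{e_i^*\otimes p},\qquad \varepsilon^\circ(\overline{p^*\otimes p})=p^*(p),$$ where $\{e_i,e_i^*\}$ is any finite dual basis of the $A$-module $P$. (The multiplication, $\Delta^\circ$ and $\varepsilon^\circ$ are well defined, $U^\circ$ is commutative, $\mathsf s^\circ$, $\mathsf t^\circ$, $\Delta^\circ$, $\varepsilon^\circ$ are algebra maps that satisfy the bialgebroid axioms, and there is an antipode.) 2. Let $\mathcal A^{U^\circ}$ be the category of right $U^\circ$-comodules whose underlying $A$-module is finitely generated and projective, which is symmetric monoidal for $M\otimes_A N$ with the coaction $m\otimes n\mapsto m_0\otimes n_0\otimes m_1n_1$, the unit object $A$ with the coaction $a\mapsto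 1\otimes\mathsf t^\circ(a)$, and the flip as symmetry. The functor $\chi:\mathcal A_U\to\mathcal A^{U^\circ}$ that is the identity on underlying $A$-modules and maps and gives $P$ the coaction $p\mapsto\sum_i e_i\otimes_A\overline{e_i^*\otimes p}$ is well defined, strict monoidal and preserves the symmetry. 3. If $\zeta$ is injective, then $\chi$ is an isomorphism of symmetric monoidal categories: it has a strict inverse functor, which is again strict monoidal and preserves the symmetry. -/

import Mathlib

open CategoryTheory MonoidalCategory TensorProduct

noncomputable section

namespace HopfDual

universe w v u

/-! ### Cocommutative right Hopf algebroids over a commutative algebra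

Let `A` be a commutative ring.  The underlying `A`-coring of a right bialgebroid `U` is the
`A`-bimodule with `a · u · b = u t(a) s(b)`, where `s`, `t` are the source and the target.
A coring is cocommutative when its bimodule is central and its comultiplication is invariant under
the flip `U ⊗[A] U → U ⊗[A] U`, so that `u t(a) = u s(a)` for all `u`, that is, `t = s`, and the
coring is an `A`-coalgebra for the right multiplication by `s(a)`. -/

/-- An `A`-ring `s : A → U` (whose image need not be central), regarded as an `A`-module through
right multiplication by `s`. -/
class ARing (A : Type u) (U : Type v) [CommRing A] [Ring U] [Module A U] where
  /-- the source map (equal to the target map) -/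
  s : A →+* U
  smul_eq : ∀ (a : A) (u : U), a • u = u * s a

section TensorExt

variable {A M N L X : Type*} [CommRing A] [AddCommGroup M] [Module A M] [AddCommGroup N]
  [Module A N] [AddCommGroup L] [Module A L] [AddCommGroup X]

theorem addHom_congr (f g : M ⊗[A] N →+ X) (h : ∀ m n, f (m ⊗ₜ n) = g (m ⊗ₜ n))
    (z : M ⊗[A] N) : f z = g z := by
  induction z with
  | zero => simp
  | add z z' hz hz' => rw [map_add, map_add, hz, hz']
  | tmul m n => exact h m n

theorem addHom_congr₃ (f g : (M ⊗[A] N) ⊗[A] L →+ X)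
    (h : ∀ m n l, f (m ⊗ₜ n ⊗ₜ l) = g (m ⊗ₜ n ⊗ₜ l)) (z : (M ⊗[A] N) ⊗[A] L) : f z = g z := by
  refine addHom_congr f g (fun z l => ?_) z
  induction z with
  | zero => simp
  | add z z' hz hz' => rw [TensorProduct.add_tmul, map_add, map_add, hz, hz']
  | tmul m n => exact h m n l

end TensorExt

section Algebroid

variable (A : Type u) {U : Type v} [CommRing A] [Ring U] [Module A U] [ARing A U]

/-- Left multiplication by `x`; it commutes with the right multiplications. -/
def lmul (x : U) : U →ₗ[A] U where
  toFun u := x * u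
  map_add' := mul_add x
  map_smul' a u := by simp [ARing.smul_eq, mul_assoc]

@[simp] theorem lmul_apply (x u : U) : lmul A x u = x * u := rfl

/-- The map `u ⊗ v ↦ x u ⊗ y v` on `U ⊗[A] U`. -/
def lmul₂ (x y : U) : U ⊗[A] U →ₗ[A] U ⊗[A] U := TensorProduct.map (lmul A x) (lmul A y)

end Algebroid

/-- A cocommutative right bialgebroid over a commutative ring `A`: the underlying coring is the
cocommutative `A`-coalgebra `U`, and these are the axioms of a right bialgebroid. -/
class CocommRightBialgebroid (A : Type u) (U : Type v) [CommRing A] [Ring U] [Module A U]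
    [Coalgebra A U] extends ARing A U, Coalgebra.IsCocomm A U where
  /-- The comultiplication takes values in the Takeuchi product: `s(a)u₁ ⊗ u₂ = u₁ ⊗ s(a)u₂`. -/
  takeuchi : ∀ (a : A) (u : U),
    (lmul A (s a)).rTensor U (Coalgebra.comul u) = (lmul A (s a)).lTensor U (Coalgebra.comul u)
  comul_one : Coalgebra.comul (R := A) (1 : U) = 1 ⊗ₜ 1
  /-- `Δ(uv) = u₁v₁ ⊗ u₂v₂`. -/
  comul_mul : ∀ (u v : U) (n : ℕ) (x y : Fin n → U),
    Coalgebra.comul (R := A) u = ∑ i, x i ⊗ₜ y i →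
      Coalgebra.comul (R := A) (u * v) = ∑ i, lmul₂ A (x i) (y i) (Coalgebra.comul v)
  counit_one : Coalgebra.counit (R := A) (1 : U) = 1
  counit_mul : ∀ u v : U,
    Coalgebra.counit (R := A) (u * v) = Coalgebra.counit (s (Coalgebra.counit (R := A) u) * v)

theorem exists_repr {A U : Type*} [CommRing A] [AddCommGroup U] [Module A U]
    (z : U ⊗[A] U) : ∃ (n : ℕ) (x y : Fin n → U), z = ∑ i, x i ⊗ₜ[A] y i := by
  induction z with
  | zero => exact ⟨0, Fin.elim0, Fin.elim0, by simp⟩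
  | tmul x y => exact ⟨1, fun _ => x, fun _ => y, by simp⟩
  | add z₁ z₂ h₁ h₂ =>
    obtain ⟨n, x, y, rfl⟩ := h₁
    obtain ⟨m, x', y', rfl⟩ := h₂
    exact ⟨n + m, Fin.append x x', Fin.append y y', by simp [Fin.sum_univ_add]⟩

section Bialgebroid

variable (A : Type u) (U : Type v) [CommRing A] [Ring U] [Module A U] [Coalgebra A U]
variable [CocommRightBialgebroid A U]

theorem s_eq (a : A) : ARing.s a = a • (1 : U) := by rw [ARing.smul_eq, one_mul]

theorem comul_s (a : A) : Coalgebra.comul (R := A) (ARing.s a : U) = ARing.s a ⊗ₜ 1 := by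
  rw [s_eq, map_smul, CocommRightBialgebroid.comul_one, TensorProduct.smul_tmul']

theorem counit_s (a : A) : Coalgebra.counit (R := A) (ARing.s a : U) = a := by
  rw [s_eq, map_smul, CocommRightBialgebroid.counit_one, smul_eq_mul, mul_one]

/-- `U` as an `A`-module through left multiplication by `s`. -/
def LeftMod (_A : Type u) (U : Type v) : Type v := U

instance : AddCommGroup (LeftMod A U) := inferInstanceAs (AddCommGroup U)

instance : Module A (LeftMod A U) := Module.compHom U (ARing.s : A →+* U)

/-- The canonical map `β : U ⊗[A] U → U ⊗[A] U`, `x ⊗ u ↦ x u₁ ⊗ u₂`, where the tensor product in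
the source is balanced by `x s(a) ⊗ u = x ⊗ s(a) u`. -/
def canonicalMap : U ⊗[A] LeftMod A U →+ U ⊗[A] U :=
  TensorProduct.liftAddHom
    (AddMonoidHom.mk' (fun x : U => AddMonoidHom.mk'
        (fun u : LeftMod A U => lmul₂ A x 1 (Coalgebra.comul (R := A) (show U from u)))
        (fun u v => by
          change lmul₂ A x 1 (Coalgebra.comul (R := A) ((show U from u) + (show U from v))) = _
          rw [map_add, map_add]))
      (fun x y => by
        ext u
        have h : lmul A (x + y) = lmul A x + lmul A y := by ext v; simp [add_mul]
        simp [lmul₂, h, TensorProduct.map_add_left]))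
    (fun a x u => by
      change lmul₂ A (a • x) 1 (Coalgebra.comul (R := A) (show U from u)) =
        lmul₂ A x 1 (Coalgebra.comul (R := A) (ARing.s a * (show U from u)))
      rw [CocommRightBialgebroid.comul_mul (ARing.s a) (show U from u) 1 (fun _ => ARing.s a)
        (fun _ => 1) (by simpa using comul_s A U a)]
      simp only [Finset.univ_unique, Finset.sum_singleton]
      generalize Coalgebra.comul (R := A) (show U from u) = z
      induction z with
      | zero => simp
      | tmul p q => simp [lmul₂, ARing.smul_eq, mul_assoc]
      | add p q hp hq => simp only [map_add, hp, hq])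

end Bialgebroid

/-- A cocommutative right Hopf algebroid over a commutative ring `A`: a cocommutative right
bialgebroid whose canonical map `β` is bijective. -/
class CocommRightHopfAlgebroid (A : Type u) (U : Type v) [CommRing A] [Ring U] [Module A U]
    [Coalgebra A U] extends CocommRightBialgebroid A U where
  bijective_canonicalMap : Function.Bijective (canonicalMap A U)

/-! ### The symmetric monoidal category of `A`-profinite right `U`-modules -/

/-- A right `U`-module whose underlying `A`-module (by restriction along `s`) is finitely generated
and projective. -/
structure ProfMod (A : Type u) (U : Type v) [CommRing A] [Ring U] [Module A U] [ARing A U] :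
    Type (max (u + 1) v) where
  carrier : Type u
  [addCommGroup : AddCommGroup carrier]
  [module : Module A carrier]
  [rightModule : Module Uᵐᵒᵖ carrier]
  [finite : Module.Finite A carrier]
  [projective : Module.Projective A carrier]
  op_s_smul : ∀ (a : A) (x : carrier), MulOpposite.op (ARing.s a : U) • x = a • x

namespace ProfMod

section Category

variable {A : Type u} {U : Type v} [CommRing A] [Ring U] [Module A U] [ARing A U]

instance : CoeSort (ProfMod A U) (Type u) := ⟨carrier⟩

attribute [instance] addCommGroup module rightModule finite projective

/-- A morphism: a right `U`-linear map (in particular `A`-linear). -/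
@[ext]
structure Hom (P Q : ProfMod A U) where
  hom : P →ₗ[A] Q
  map_op_smul : ∀ (u : U) (x : P), hom (MulOpposite.op u • x) = MulOpposite.op u • hom x

instance : Category (ProfMod A U) where
  Hom := Hom
  id P := ⟨LinearMap.id, fun _ _ => rfl⟩
  comp f g := ⟨g.hom ∘ₗ f.hom, fun u x => by simp [f.map_op_smul, g.map_op_smul]⟩

/-- The underlying `A`-linear map of a morphism. -/
def Hom.lin {P Q : ProfMod A U} (f : P ⟶ Q) : P →ₗ[A] Q := Hom.hom f

theorem lin_op_smul {P Q : ProfMod A U} (f : P ⟶ Q) (u : U) (x : P) :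
    Hom.lin f (MulOpposite.op u • x) = MulOpposite.op u • Hom.lin f x := Hom.map_op_smul f u x

@[ext] theorem hom_ext {P Q : ProfMod A U} {f g : P ⟶ Q} (h : Hom.lin f = Hom.lin g) : f = g :=
  Hom.ext h

/-- The fibre functor to `A`-modules. -/
def forget (A : Type u) (U : Type v) [CommRing A] [Ring U] [Module A U] [ARing A U] :
    ProfMod A U ⥤ ModuleCat.{u} A where
  obj P := ModuleCat.of A P
  map f := ModuleCat.ofHom (Hom.lin f)

instance : (forget A U).Faithful where
  map_injective h := hom_ext (ModuleCat.hom_ext_iff.1 h)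

/-- An `A`-linear isomorphism commuting with the actions of `U` is an isomorphism. -/
def isoMk {P Q : ProfMod A U} (e : P ≃ₗ[A] Q)
    (he : ∀ (u : U) (x : P), e (MulOpposite.op u • x) = MulOpposite.op u • e x) : P ≅ Q where
  hom := ⟨e, he⟩
  inv := ⟨e.symm, fun u x => e.injective (by simp [he])⟩
  hom_inv_id := Hom.ext (by ext x; exact e.symm_apply_apply x)
  inv_hom_id := Hom.ext (by ext x; exact e.apply_symm_apply x)

/-- The orbit map `u ↦ p u`. -/
def orbit (P : ProfMod A U) (p : P) : U →ₗ[A] P where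
  toFun u := MulOpposite.op u • p
  map_add' u v := by simp [add_smul]
  map_smul' a u := by
    rw [ARing.smul_eq, MulOpposite.op_mul, mul_smul, op_s_smul, RingHom.id_apply]

@[simp] theorem orbit_apply (P : ProfMod A U) (p : P) (u : U) :
    P.orbit p u = MulOpposite.op u • p := rfl

theorem orbit_add (P : ProfMod A U) (p q : P) : P.orbit (p + q) = P.orbit p + P.orbit q := by
  ext u; simp

theorem orbit_smul (P : ProfMod A U) (a : A) (p : P) :
    P.orbit (a • p) = P.orbit p ∘ₗ lmul A (ARing.s a) := by
  ext u; simp [← op_s_smul, mul_smul]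

theorem orbit_op_smul (P : ProfMod A U) (x : U) (p : P) :
    P.orbit (MulOpposite.op x • p) = P.orbit p ∘ₗ lmul A x := by
  ext u; simp [mul_smul]

end Category

section Monoidal

variable {A : Type u} {U : Type v} [CommRing A] [Ring U] [Module A U] [Coalgebra A U]
variable [CocommRightBialgebroid A U]

/-- The map `u ↦ p u₁ ⊗ q u₂`. -/
def orbit₂ (P Q : ProfMod A U) (p : P) (q : Q) : U →ₗ[A] P ⊗[A] Q :=
  TensorProduct.map (P.orbit p) (Q.orbit q) ∘ₗ Coalgebra.comul

theorem orbit₂_balanced (P Q : ProfMod A U) (a : A) (p : P) (q : Q) (u : U) :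
    orbit₂ P Q (a • p) q u = orbit₂ P Q p (a • q) u := by
  have h := congrArg (TensorProduct.map (P.orbit p) (Q.orbit q))
    (CocommRightBialgebroid.takeuchi a u)
  have e₁ : ∀ w : U ⊗[A] U, TensorProduct.map (P.orbit p) (Q.orbit q)
      ((lmul A (ARing.s a)).rTensor U w) = TensorProduct.map (P.orbit (a • p)) (Q.orbit q) w :=
    fun w => by rw [orbit_smul, LinearMap.map_rTensor]
  have e₂ : ∀ w : U ⊗[A] U, TensorProduct.map (P.orbit p) (Q.orbit q)
      ((lmul A (ARing.s a)).lTensor U w) = TensorProduct.map (P.orbit p) (Q.orbit (a • q)) w :=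
    fun w => by rw [orbit_smul, LinearMap.map_lTensor]
  rw [e₁, e₂] at h
  exact h

/-- The action `(p ⊗ q) u = p u₁ ⊗ q u₂` on the tensor product. -/
def tensorAct (P Q : ProfMod A U) (u : U) : P ⊗[A] Q →+ P ⊗[A] Q :=
  TensorProduct.liftAddHom
    (AddMonoidHom.mk' (fun p => AddMonoidHom.mk' (fun q => orbit₂ P Q p q u)
        (fun q q' => by simp [orbit₂, orbit_add, TensorProduct.map_add_right]))
      (fun p p' => by ext q; simp [orbit₂, orbit_add, TensorProduct.map_add_left]))
    (fun a p q => orbit₂_balanced P Q a p q u)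

@[simp] theorem tensorAct_tmul (P Q : ProfMod A U) (u : U) (p : P) (q : Q) :
    tensorAct P Q u (p ⊗ₜ q) = orbit₂ P Q p q u := rfl

theorem tensorAct_mul (P Q : ProfMod A U) (u v : U) (z : P ⊗[A] Q) :
    tensorAct P Q (u * v) z = tensorAct P Q v (tensorAct P Q u z) := by
  induction z with
  | zero => simp
  | add z z' h h' => simp only [map_add, h, h']
  | tmul p q =>
    obtain ⟨n, x, y, hxy⟩ := exists_repr (Coalgebra.comul (R := A) u)
    simp only [tensorAct_tmul, orbit₂, LinearMap.comp_apply]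
    rw [CocommRightBialgebroid.comul_mul u v n x y hxy, hxy]
    simp only [map_sum, TensorProduct.map_tmul, tensorAct_tmul, orbit₂, LinearMap.comp_apply,
      orbit_apply, orbit_op_smul, TensorProduct.map_comp, lmul₂]

/-- The tensor product of right `U`-modules. -/
def tensorObj (P Q : ProfMod A U) : ProfMod A U :=
  letI : Module Uᵐᵒᵖ (P ⊗[A] Q) :=
    { smul := fun u z => tensorAct P Q u.unop z
      one_smul := fun z => by
        change tensorAct P Q 1 z = z
        induction z with
        | zero => simp
        | add z z' h h' => simp only [map_add, h, h']
        | tmul p q => simp [orbit₂, CocommRightBialgebroid.comul_one]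
      mul_smul := fun u v z => tensorAct_mul P Q v.unop u.unop z
      smul_zero := fun u => map_zero _
      smul_add := fun u => map_add _
      add_smul := fun u v z => by
        change tensorAct P Q (u.unop + v.unop) z = tensorAct P Q u.unop z + tensorAct P Q v.unop z
        induction z with
        | zero => simp
        | add z z' h h' => simp only [map_add, h, h']; abel
        | tmul p q => simp
      zero_smul := fun z => by
        change tensorAct P Q 0 z = 0
        induction z with
        | zero => simp
        | add z z' h h' => simp only [map_add, h, h', add_zero]
        | tmul p q => simp }
  { carrier := P ⊗[A] Q
    op_s_smul := fun a z => by
      change tensorAct P Q (ARing.s a) z = a • z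
      induction z with
      | zero => simp
      | add z z' h h' => simp only [map_add, h, h', smul_add]
      | tmul p q => simp [orbit₂, comul_s, op_s_smul, TensorProduct.smul_tmul'] }

theorem op_smul_tensor (P Q : ProfMod A U) (u : U) (z : P ⊗[A] Q) :
    (MulOpposite.op u • (show tensorObj P Q from z) : tensorObj P Q) = tensorAct P Q u z := rfl

/-- The unit object: `A` with the action `a u = ε(s(a) u)`. -/
def unitObj (A : Type u) (U : Type v) [CommRing A] [Ring U] [Module A U] [Coalgebra A U]
    [CocommRightBialgebroid A U] : ProfMod A U :=
  letI : Module Uᵐᵒᵖ A :=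
    { smul := fun u a => Coalgebra.counit (R := A) (ARing.s a * u.unop : U)
      one_smul := fun a => by
        change Coalgebra.counit (R := A) (ARing.s a * 1 : U) = a
        rw [mul_one, counit_s]
      mul_smul := fun u v a => by
        change Coalgebra.counit (R := A) (ARing.s a * (v.unop * u.unop) : U) =
          Coalgebra.counit (R := A)
            (ARing.s (Coalgebra.counit (R := A) (ARing.s a * v.unop : U)) * u.unop : U)
        rw [← mul_assoc, CocommRightBialgebroid.counit_mul]
      smul_zero := fun u => by
        change Coalgebra.counit (R := A) (ARing.s 0 * u.unop : U) = 0
        simp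
      smul_add := fun u a b => by
        change Coalgebra.counit (R := A) (ARing.s (a + b) * u.unop : U) =
          Coalgebra.counit (R := A) (ARing.s a * u.unop : U) +
            Coalgebra.counit (R := A) (ARing.s b * u.unop : U)
        simp [add_mul]
      add_smul := fun u v a => by
        change Coalgebra.counit (R := A) (ARing.s a * (u.unop + v.unop) : U) =
          Coalgebra.counit (R := A) (ARing.s a * u.unop : U) +
            Coalgebra.counit (R := A) (ARing.s a * v.unop : U)
        simp [mul_add]
      zero_smul := fun a => by
        change Coalgebra.counit (R := A) (ARing.s a * 0 : U) = 0
        simp }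
  { carrier := A
    op_s_smul := fun a b => by
      change Coalgebra.counit (R := A) (ARing.s b * ARing.s a : U) = a • b
      rw [← map_mul, counit_s, smul_eq_mul, mul_comm] }

theorem op_smul_unit (u : U) (a : A) :
    (MulOpposite.op u • (show unitObj A U from a) : unitObj A U) =
      Coalgebra.counit (R := A) (ARing.s a * u) := rfl

/-- The tensor product of morphisms. -/
def tensorHom {P P' Q Q' : ProfMod A U} (f : P ⟶ P') (g : Q ⟶ Q') :
    tensorObj P Q ⟶ tensorObj P' Q' where
  hom := TensorProduct.map (Hom.lin f) (Hom.lin g)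
  map_op_smul u z := by
    change TensorProduct.map (Hom.lin f) (Hom.lin g) (tensorAct P Q u z) =
      tensorAct P' Q' u (TensorProduct.map (Hom.lin f) (Hom.lin g) z)
    induction z using TensorProduct.induction_on with
    | zero => simp
    | add z z' h h' => simp only [map_add, h, h']
    | tmul p q =>
      have hf : P'.orbit (Hom.lin f p) = Hom.lin f ∘ₗ P.orbit p := by
        ext u; simp [lin_op_smul]
      have hg : Q'.orbit (Hom.lin g q) = Hom.lin g ∘ₗ Q.orbit q := by
        ext u; simp [lin_op_smul]
      simp [orbit₂, hf, hg, TensorProduct.map_comp]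

theorem assoc_orbit (P Q R : ProfMod A U) (p : P) (q : Q) (r : R) (u : U) :
    TensorProduct.assoc A P Q R
        (TensorProduct.map (orbit₂ P Q p q) (R.orbit r) (Coalgebra.comul u)) =
      TensorProduct.map (P.orbit p) (orbit₂ Q R q r) (Coalgebra.comul u) := by
  have h₁ : ∀ w : U ⊗[A] U, TensorProduct.map (orbit₂ P Q p q) (R.orbit r) w =
      TensorProduct.map (TensorProduct.map (P.orbit p) (Q.orbit q)) (R.orbit r)
        (Coalgebra.comul.rTensor U w) := fun w => by rw [LinearMap.map_rTensor, orbit₂]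
  have h₂ : ∀ w : U ⊗[A] U, TensorProduct.map (P.orbit p) (orbit₂ Q R q r) w =
      TensorProduct.map (P.orbit p) (TensorProduct.map (Q.orbit q) (R.orbit r))
        (Coalgebra.comul.lTensor U w) := fun w => by rw [LinearMap.map_lTensor, orbit₂]
  have h₃ : ∀ w : (U ⊗[A] U) ⊗[A] U, TensorProduct.assoc A P Q R
      (TensorProduct.map (TensorProduct.map (P.orbit p) (Q.orbit q)) (R.orbit r) w) =
      TensorProduct.map (P.orbit p) (TensorProduct.map (Q.orbit q) (R.orbit r))
        (TensorProduct.assoc A U U U w) := fun w =>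
    LinearMap.congr_fun
      (TensorProduct.map_map_comp_assoc_eq (P.orbit p) (Q.orbit q) (R.orbit r)).symm w
  rw [h₁, h₂, h₃, Coalgebra.coassoc_apply]

/-- The associator. -/
def assocIso (P Q R : ProfMod A U) :
    tensorObj (tensorObj P Q) R ≅ tensorObj P (tensorObj Q R) :=
  isoMk (TensorProduct.assoc A P Q R) fun u z =>
    addHom_congr₃ (A := A) (M := P) (N := Q) (L := R) (X := P ⊗[A] (Q ⊗[A] R))
      ((TensorProduct.assoc A P Q R).toLinearMap.toAddMonoidHom.comp
        (tensorAct (tensorObj P Q) R u))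
      ((tensorAct P (tensorObj Q R) u).comp
        (TensorProduct.assoc A P Q R).toLinearMap.toAddMonoidHom)
      (fun p q r => assoc_orbit P Q R p q r u) z

theorem lid_orbit (P : ProfMod A U) (p : P) (u : U) :
    TensorProduct.lid A P (TensorProduct.map (Coalgebra.counit (R := A)) (P.orbit p)
      (Coalgebra.comul u)) = MulOpposite.op u • p := by
  have h : ∀ w : U ⊗[A] U, TensorProduct.lid A P
      (TensorProduct.map (Coalgebra.counit (R := A)) (P.orbit p) w) =
      P.orbit p (TensorProduct.lid A U (Coalgebra.counit.rTensor U w)) := fun w => by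
    induction w with
    | zero => simp
    | add z z' h h' => simp only [map_add, h, h']
    | tmul x y =>
      rw [TensorProduct.map_tmul, TensorProduct.lid_tmul, LinearMap.rTensor_tmul,
        TensorProduct.lid_tmul, map_smul]
  rw [h, Coalgebra.rTensor_counit_comul, TensorProduct.lid_tmul, one_smul, orbit_apply]

theorem orbit_unit_one : (unitObj A U).orbit (1 : A) = (Coalgebra.counit : U →ₗ[A] A) :=
  LinearMap.ext fun u =>
    (congrArg (Coalgebra.counit (R := A) (A := U)) (by rw [map_one, one_mul]) :
      Coalgebra.counit (R := A) (ARing.s (1 : A) * u : U) = Coalgebra.counit (R := A) u)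

/-- The left unitor. -/
def leftUnitorIso (P : ProfMod A U) : tensorObj (unitObj A U) P ≅ P :=
  isoMk (TensorProduct.lid A P) fun u z => by
    have h : ∀ (a : A) (p : P), TensorProduct.lid A P (TensorProduct.map
        ((unitObj A U).orbit a) (P.orbit p) (Coalgebra.comul u)) =
        MulOpposite.op u • (a • p) := fun a p => by
      have h₁ := orbit₂_balanced (unitObj A U) P a (1 : A) p u
      have h₂ : a • (1 : A) = a := by simp
      have h₃ := lid_orbit P (a • p) u
      rw [← orbit_unit_one] at h₃
      refine Eq.trans ?_ h₃
      refine congrArg (TensorProduct.lid A P) (Eq.trans ?_ h₁)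
      exact congrArg (fun b : A => orbit₂ (unitObj A U) P b p u) h₂.symm
    let act : A ⊗[A] P →+ A ⊗[A] P := tensorAct (unitObj A U) P u
    exact addHom_congr ((TensorProduct.lid A P).toLinearMap.toAddMonoidHom.comp act)
      ((DistribSMul.toAddMonoidHom P (MulOpposite.op u)).comp
        (TensorProduct.lid A P).toLinearMap.toAddMonoidHom)
      (fun a p => (h a p).trans
        (congrArg (fun x : P => MulOpposite.op u • x) (TensorProduct.lid_tmul p a).symm)) z

/-- The symmetry, which is the flip. -/
def braidIso (P Q : ProfMod A U) : tensorObj P Q ≅ tensorObj Q P :=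
  isoMk (TensorProduct.comm A P Q) fun u z => by
    change TensorProduct.comm A P Q (tensorAct P Q u z) =
      tensorAct Q P u (TensorProduct.comm A P Q z)
    induction z using TensorProduct.induction_on with
    | zero => simp
    | add z z' h h' => simp only [map_add, h, h']
    | tmul p q =>
      have h : ∀ w : U ⊗[A] U, TensorProduct.comm A P Q
          (TensorProduct.map (P.orbit p) (Q.orbit q) w) =
          TensorProduct.map (Q.orbit q) (P.orbit p) (TensorProduct.comm A U U w) := fun w => by
        induction w with
        | zero => simp
        | add z z' h h' => simp only [map_add, h, h']
        | tmul x y => simp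
      simp only [tensorAct_tmul, TensorProduct.comm_tmul, orbit₂, LinearMap.comp_apply]
      rw [h, Coalgebra.comm_comul]

/-- The right unitor. -/
def rightUnitorIso (P : ProfMod A U) : tensorObj P (unitObj A U) ≅ P :=
  isoMk (TensorProduct.rid A P) fun u z => by
    have h := (braidIso P (unitObj A U) ≪≫ leftUnitorIso P).hom.map_op_smul u z
    have e : ∀ y : P ⊗[A] A,
        TensorProduct.lid A P (TensorProduct.comm A P A y) = TensorProduct.rid A P y :=
      fun y => by
        induction y with
        | zero => simp
        | add z z' h h' => simp only [map_add, h, h']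
        | tmul x y => simp
    exact (e _).symm.trans (h.trans (congrArg _ (e z)))

instance : MonoidalCategoryStruct (ProfMod A U) where
  tensorObj := tensorObj
  whiskerLeft P _ _ f := tensorHom (𝟙 P) f
  whiskerRight f Q := tensorHom f (𝟙 Q)
  tensorHom := tensorHom
  tensorUnit := unitObj A U
  associator := assocIso
  leftUnitor := leftUnitorIso
  rightUnitor := rightUnitorIso

/-- The fibre functor strictly preserves the monoidal structure. -/
def forgetData : Monoidal.InducingFunctorData (forget A U) where
  μIso _ _ := Iso.refl _
  εIso := Iso.refl _
  whiskerLeft_eq _ _ _ _ := ModuleCat.hom_ext (TensorProduct.ext' fun _ _ => rfl)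
  whiskerRight_eq _ _ := ModuleCat.hom_ext (TensorProduct.ext' fun _ _ => rfl)
  tensorHom_eq _ _ := ModuleCat.hom_ext (TensorProduct.ext' fun _ _ => rfl)
  associator_eq _ _ _ := ModuleCat.hom_ext (TensorProduct.ext_threefold fun _ _ _ => rfl)
  leftUnitor_eq _ := ModuleCat.hom_ext (TensorProduct.ext' fun _ _ => rfl)
  rightUnitor_eq _ := ModuleCat.hom_ext (TensorProduct.ext' fun _ _ => rfl)

instance : MonoidalCategory (ProfMod A U) := Monoidal.induced (forget A U) forgetData

instance : (forget A U).Monoidal := Monoidal.fromInducedMonoidal (forget A U) forgetData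

instance : BraidedCategory (ProfMod A U) :=
  BraidedCategory.ofFaithful (forget A U) braidIso fun _ _ =>
    ModuleCat.hom_ext (TensorProduct.ext' fun _ _ => rfl)

instance : SymmetricCategory (ProfMod A U) where
  symmetry _ _ := hom_ext (TensorProduct.ext' fun _ _ => rfl)

end Monoidal

end ProfMod

/-! ### Commutative Hopf algebroids and their profinite comodules -/

/-- The ring `H` regarded as an algebra over `A` through the ring homomorphism `f : A → H`. -/
def Via {A : Type u} {H : Type w} [CommRing A] [CommRing H] (_f : A →+* H) : Type w := H

section Via

variable {A : Type u} {H : Type w} [CommRing A] [CommRing H] (f : A →+* H)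

instance : CommRing (Via f) := inferInstanceAs (CommRing H)

instance : Algebra A (Via f) := f.toAlgebra

/-- The identity map `H → Via f`. -/
def toVia : H →+* Via f := RingHom.id H

theorem via_smul (a : A) (h : H) : a • toVia f h = toVia f (f a * h) := rfl

end Via

/-- The source, target, comultiplication and counit of a commutative bialgebroid `H` over `A`,
relative to the ground ring `R`, and their compatibility with source and target.  As an `A`-bimodule
`a · h · b = s(a) h t(b)`, so that `H ⊗_A H`, balanced by `h t(a) ⊗ h' = h ⊗ s(a) h'`, is
`Via t ⊗[A] Via s`. -/
structure CommBialgebroidData (R A H : Type*) [CommRing R] [CommRing A] [Algebra R A] [CommRing H]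
    [Algebra R H] where
  /-- source -/
  s : A →ₐ[R] H
  /-- target -/
  t : A →ₐ[R] H
  /-- comultiplication -/
  comul : H →+* Via (t : A →+* H) ⊗[A] Via (s : A →+* H)
  /-- counit -/
  counit : H →+* A
  comul_s : ∀ a, comul (s a) = toVia _ (s a) ⊗ₜ 1
  comul_t : ∀ a, comul (t a) = 1 ⊗ₜ toVia _ (t a)
  counit_s : ∀ a, counit (s a) = a
  counit_t : ∀ a, counit (t a) = a

namespace CommBialgebroidData

variable {R A H : Type*} [CommRing R] [CommRing A] [Algebra R A] [CommRing H] [Algebra R H]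
variable (C : CommBialgebroidData R A H)

/-- `H` as an `A`-algebra through the source. -/
abbrev Src : Type _ := Via (C.s : A →+* H)

/-- `H` as an `A`-algebra through the target. -/
abbrev Tgt : Type _ := Via (C.t : A →+* H)

/-- The identity map from `H` to `H` regarded as an `A`-algebra through the source. -/
abbrev toSrc : H →+* C.Src := toVia _

/-- The identity map from `H` to `H` regarded as an `A`-algebra through the target. -/
abbrev toTgt : H →+* C.Tgt := toVia _

/-- The ring homomorphism `A → H ⊗_A H`, `a ↦ s(a) ⊗ 1`. -/
def srcSq : A →+* C.Tgt ⊗[A] C.Src :=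
  (Algebra.TensorProduct.includeLeft : C.Tgt →ₐ[A] C.Tgt ⊗[A] C.Src).toRingHom.comp
    (C.s : A →+* H)

/-- `H ⊗_A H` as an `A`-algebra through the source of the first factor. -/
abbrev SrcSq : Type _ := Via C.srcSq

/-- The comultiplication `H → H ⊗_A H`, which is linear for the left `A`-actions. -/
def comulLin : C.Src →ₗ[A] C.SrcSq where
  toFun h := C.comul h
  map_add' := map_add C.comul
  map_smul' a h := (map_mul C.comul (C.s a) h).trans
    (congrArg (fun z : C.Tgt ⊗[A] C.Src => z * C.comul h) (C.comul_s a))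

/-- The map `x ↦ x ⊗ h` from `H` to `H ⊗_A H`. -/
def append (h : H) : C.Src →ₗ[A] C.SrcSq where
  toFun x := (show C.Tgt from x) ⊗ₜ[A] (C.toSrc h)
  map_add' x y := TensorProduct.add_tmul (R := A) (show C.Tgt from x) (show C.Tgt from y)
    (C.toSrc h)
  map_smul' a x := by
    change (C.toTgt (C.s a) * (show C.Tgt from x)) ⊗ₜ[A] C.toSrc h =
      (C.toTgt (C.s a) ⊗ₜ[A] (1 : C.Src)) * ((show C.Tgt from x) ⊗ₜ[A] C.toSrc h)
    rw [Algebra.TensorProduct.tmul_mul_tmul, one_mul]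

/-- Multiplication by `h` on `H`, linear for the left `A`-action. -/
def mulSrc (h : H) : C.Src →ₗ[A] C.Src := LinearMap.mulLeft A (C.toSrc h)

@[simp] theorem mulSrc_apply (h : H) (x : C.Src) : C.mulSrc h x = C.toSrc h * x := rfl

/-- The counit, linear for the left `A`-action. -/
def counitLin : C.Src →ₗ[A] A where
  toFun h := C.counit h
  map_add' := map_add C.counit
  map_smul' a h := (map_mul C.counit (C.s a) h).trans
    (congrArg (fun b : A => b * C.counit h) (C.counit_s a))

section Coaction

variable {M : Type*} [AddCommGroup M] [Module A M]

/-- For `ρ : M → M ⊗_A H` that is linear for the right `A`-actions (on the right-hand side through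
the target), the map `ρ ⊗ H : M ⊗_A H → M ⊗_A H ⊗_A H`. -/
def coactTensor (ρ : M →+ M ⊗[A] C.Src)
    (hρ : ∀ (a : A) (m : M), ρ (a • m) = (C.mulSrc (C.t a)).lTensor M (ρ m)) :
    M ⊗[A] C.Src →+ M ⊗[A] C.SrcSq :=
  TensorProduct.liftAddHom
    (AddMonoidHom.mk' (fun m : M => AddMonoidHom.mk'
        (fun h : C.Src => (C.append h).lTensor M (ρ m))
        (fun h h' => by
          have e : C.append (show H from h + h') = C.append h + C.append h' := LinearMap.ext fun x =>
            TensorProduct.tmul_add (R := A) (show C.Tgt from x) h h'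
          change (C.append (show H from h + h')).lTensor M (ρ m) = _
          rw [e, LinearMap.lTensor_add, LinearMap.add_apply]))
      (fun m m' => by ext h; simp))
    (fun a m h => by
      change (C.append h).lTensor M (ρ (a • m)) = (C.append (C.s a * (show H from h))).lTensor M (ρ m)
      have e : C.append h ∘ₗ C.mulSrc (C.t a) = C.append (C.s a * (show H from h)) :=
        LinearMap.ext fun x => TensorProduct.smul_tmul (R := A) a (show C.Tgt from x) h
      rw [hρ, ← LinearMap.comp_apply, ← LinearMap.lTensor_comp, e])

end Coaction

/-- The comultiplication as a coaction of `H` on itself, viewed as a right `A`-module through the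
target. -/
def comulCoact : C.Tgt →+ C.Tgt ⊗[A] C.Src := C.comul.toAddMonoidHom

theorem comulCoact_smul (a : A) (h : C.Tgt) :
    C.comulCoact (a • h) = (C.mulSrc (C.t a)).lTensor C.Tgt (C.comulCoact h) := by
  refine (map_mul C.comul (C.t a) h).trans ?_
  rw [C.comul_t]
  change ((1 : C.Tgt) ⊗ₜ[A] C.toSrc (C.t a)) * C.comulCoact h = _
  generalize C.comulCoact h = z
  induction z with
  | zero => simp
  | add z z' hz hz' => rw [mul_add, map_add, hz, hz']
  | tmul x y => rw [Algebra.TensorProduct.tmul_mul_tmul, one_mul]; rfl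

/-- The ring homomorphism `H ⊗_A H → B`, `x ⊗ y ↦ f(x) g(y)`, for `f, g : H → B` with
`f ∘ t = g ∘ s`. -/
def pair {B : Type*} [CommRing B] (f g : H →+* B) (hfg : ∀ a, f (C.t a) = g (C.s a)) :
    C.Tgt ⊗[A] C.Src →+* B :=
  letI : Algebra A B := (g.comp (C.s : A →+* H)).toAlgebra
  (Algebra.TensorProduct.productMap
    ({ toRingHom := f, commutes' := hfg } : C.Tgt →ₐ[A] B)
    ({ toRingHom := g, commutes' := fun _ => rfl } : C.Src →ₐ[A] B)).toRingHom

theorem pair_tmul {B : Type*} [CommRing B] (f g : H →+* B) (hfg : ∀ a, f (C.t a) = g (C.s a))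
    (x y : H) : C.pair f g hfg ((C.toTgt x) ⊗ₜ (C.toSrc y)) = f x * g y := rfl

end CommBialgebroidData

/-- A commutative Hopf algebroid `(A, H)` over the ground ring `R`. -/
structure CommHopfAlgebroid (R A H : Type*) [CommRing R] [CommRing A] [Algebra R A] [CommRing H]
    [Algebra R H] extends CommBialgebroidData R A H where
  /-- `(H ⊗ Δ) Δ = (Δ ⊗ H) Δ` -/
  coassoc : ∀ h : H,
    toCommBialgebroidData.comulLin.lTensor toCommBialgebroidData.Tgt (comul h) =
      toCommBialgebroidData.coactTensor toCommBialgebroidData.comulCoact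
        toCommBialgebroidData.comulCoact_smul (comul h)
  /-- `s(ε(h₁)) h₂ = h` -/
  counit_left : ∀ h : H,
    toCommBialgebroidData.pair ((s : A →+* H).comp counit) (RingHom.id H)
      (fun a => congrArg s (counit_t a)) (comul h) = h
  /-- `h₁ t(ε(h₂)) = h` -/
  counit_right : ∀ h : H,
    toCommBialgebroidData.pair (RingHom.id H) ((t : A →+* H).comp counit)
      (fun a => (congrArg t (counit_s a)).symm) (comul h) = h
  /-- antipode -/
  antipode : H →+* H
  antipode_s : ∀ a, antipode (s a) = t a
  antipode_t : ∀ a, antipode (t a) = s a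
  /-- `S(h₁) h₂ = t(ε(h))` -/
  antipode_left : ∀ h : H,
    toCommBialgebroidData.pair antipode (RingHom.id H) antipode_t (comul h) = t (counit h)
  /-- `h₁ S(h₂) = s(ε(h))` -/
  antipode_right : ∀ h : H,
    toCommBialgebroidData.pair (RingHom.id H) antipode (fun a => (antipode_s a).symm) (comul h) =
      s (counit h)

/-- A right `H`-comodule whose underlying `A`-module is finitely generated and projective. -/
structure ProfComod {R : Type*} {A : Type u} {H : Type*} [CommRing R] [CommRing A] [Algebra R A]
    [CommRing H] [Algebra R H] (C : CommBialgebroidData R A H) where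
  carrier : Type u
  [addCommGroup : AddCommGroup carrier]
  [module : Module A carrier]
  [finite : Module.Finite A carrier]
  [projective : Module.Projective A carrier]
  /-- the coaction `M → M ⊗_A H` -/
  coact : carrier →+ carrier ⊗[A] C.Src
  /-- The coaction is right `A`-linear. -/
  coact_smul : ∀ (a : A) (m : carrier),
    coact (a • m) = (C.mulSrc (C.t a)).lTensor carrier (coact m)
  coassoc : ∀ m : carrier,
    C.comulLin.lTensor carrier (coact m) = C.coactTensor coact coact_smul (coact m)
  counit : ∀ m : carrier,
    TensorProduct.rid A carrier (C.counitLin.lTensor carrier (coact m)) = m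

namespace ProfComod

variable {R : Type*} {A : Type u} {H : Type*} [CommRing R] [CommRing A] [Algebra R A]
  [CommRing H] [Algebra R H] {C : CommBialgebroidData R A H}

instance : CoeSort (ProfComod C) (Type u) := ⟨carrier⟩

attribute [instance] addCommGroup module finite projective

/-- A morphism of comodules: an `A`-linear map that is colinear. -/
@[ext]
structure Hom (M N : ProfComod C) where
  hom : M →ₗ[A] N
  colinear : ∀ m : M, hom.rTensor C.Src (M.coact m) = N.coact (hom m)

instance : Category (ProfComod C) where
  Hom := Hom
  id M := ⟨LinearMap.id, fun _ => by simp⟩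
  comp f g := ⟨g.hom ∘ₗ f.hom, fun m => by
    rw [LinearMap.rTensor_comp, LinearMap.comp_apply, f.colinear, g.colinear]; rfl⟩

/-- The underlying `A`-linear map of a morphism. -/
def Hom.lin {M N : ProfComod C} (f : M ⟶ N) : M →ₗ[A] N := Hom.hom f

theorem lin_colinear {M N : ProfComod C} (f : M ⟶ N) (m : M) :
    (Hom.lin f).rTensor C.Src (M.coact m) = N.coact (Hom.lin f m) := Hom.colinear f m

@[ext] theorem hom_ext {M N : ProfComod C} {f g : M ⟶ N} (h : Hom.lin f = Hom.lin g) : f = g :=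
  Hom.ext h

/-- The forgetful functor to `A`-modules. -/
def forget (C : CommBialgebroidData R A H) : ProfComod C ⥤ ModuleCat.{u} A where
  obj M := ModuleCat.of A M
  map f := ModuleCat.ofHom (Hom.lin f)

instance : (forget C).Faithful where
  map_injective h := hom_ext (ModuleCat.hom_ext_iff.1 h)

/-- A colinear `A`-linear isomorphism is an isomorphism of comodules. -/
def isoMk {M N : ProfComod C} (e : M ≃ₗ[A] N)
    (he : ∀ m : M, e.toLinearMap.rTensor C.Src (M.coact m) = N.coact (e m)) : M ≅ N where
  hom := ⟨e, he⟩
  inv := ⟨e.symm, fun n => by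
    obtain ⟨m, rfl⟩ := e.surjective n
    rw [← he, ← LinearMap.comp_apply, ← LinearMap.rTensor_comp]
    simp⟩
  hom_inv_id := Hom.ext (by ext x; exact e.symm_apply_apply x)
  inv_hom_id := Hom.ext (by ext x; exact e.apply_symm_apply x)

section Diag

variable {M N L : Type*} [AddCommGroup M] [Module A M] [AddCommGroup N] [Module A N]
  [AddCommGroup L] [Module A L] {B : Type*} [CommRing B] [Algebra A B]

/-- The map `(m ⊗ h) ⊗ (n ⊗ k) ↦ (m ⊗ n) ⊗ h k`. -/
def diag (A M N B : Type*) [CommRing A] [AddCommGroup M] [Module A M] [AddCommGroup N]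
    [Module A N] [CommRing B] [Algebra A B] :
    (M ⊗[A] B) →ₗ[A] (N ⊗[A] B) →ₗ[A] (M ⊗[A] N) ⊗[A] B :=
  TensorProduct.curry
    ((LinearMap.mul' A B).lTensor (M ⊗[A] N) ∘ₗ
      (TensorProduct.tensorTensorTensorComm A M B N B).toLinearMap)

@[simp] theorem diag_tmul (m : M) (n : N) (h k : B) :
    diag A M N B (m ⊗ₜ h) (n ⊗ₜ k) = (m ⊗ₜ n) ⊗ₜ (h * k) := rfl

end Diag

/-- The coaction `m ⊗ n ↦ m₀ ⊗ n₀ ⊗ m₁ n₁` on the tensor product. -/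
def tensorCoact (M N : ProfComod C) : M ⊗[A] N →+ (M ⊗[A] N) ⊗[A] C.Src :=
  TensorProduct.liftAddHom
    (AddMonoidHom.mk' (fun m => AddMonoidHom.mk'
        (fun n => diag A M N C.Src (M.coact m) (N.coact n)) (fun n n' => by simp))
      (fun m m' => by ext n; simp))
    (fun a m n => by
      change diag A M N C.Src (M.coact (a • m)) (N.coact n) =
        diag A M N C.Src (M.coact m) (N.coact (a • n))
      rw [M.coact_smul, N.coact_smul]
      generalize M.coact m = x
      generalize N.coact n = y
      induction x with
      | zero => simp
      | add x x' hx hx' => simp only [map_add, LinearMap.add_apply, hx, hx']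
      | tmul m h =>
        induction y with
        | zero => simp
        | add y y' hy hy' => simp only [map_add, hy, hy']
        | tmul n k =>
          simp only [LinearMap.lTensor_tmul, diag_tmul, CommBialgebroidData.mulSrc_apply]
          rw [mul_assoc, mul_left_comm])

theorem tensorCoact_tmul (M N : ProfComod C) (m : M) (n : N) :
    tensorCoact M N (m ⊗ₜ n) = diag A M N C.Src (M.coact m) (N.coact n) := rfl

theorem mulSrc_diag {M N : Type*} [AddCommGroup M] [Module A M] [AddCommGroup N] [Module A N]
    (h : H) (x : M ⊗[A] C.Src) (y : N ⊗[A] C.Src) :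
    (C.mulSrc h).lTensor (M ⊗[A] N) (diag A M N C.Src x y) =
      diag A M N C.Src ((C.mulSrc h).lTensor M x) y := by
  induction x with
  | zero => simp
  | add x x' hx hx' => simp only [map_add, LinearMap.add_apply, hx, hx']
  | tmul m k =>
    induction y with
    | zero => simp
    | add y y' hy hy' => simp only [map_add, hy, hy']
    | tmul n k' =>
      simp only [LinearMap.lTensor_tmul, diag_tmul, CommBialgebroidData.mulSrc_apply, mul_assoc]

theorem tensorCoact_smul (M N : ProfComod C) (a : A) (z : M ⊗[A] N) :
    tensorCoact M N (a • z) = (C.mulSrc (C.t a)).lTensor (M ⊗[A] N) (tensorCoact M N z) := by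
  induction z with
  | zero => simp
  | add z z' hz hz' => simp only [smul_add, map_add, hz, hz']
  | tmul m n => rw [TensorProduct.smul_tmul', tensorCoact_tmul, tensorCoact_tmul, M.coact_smul,
      mulSrc_diag]

theorem comulLin_diag {M N : Type*} [AddCommGroup M] [Module A M] [AddCommGroup N] [Module A N]
    (x : M ⊗[A] C.Src) (y : N ⊗[A] C.Src) :
    C.comulLin.lTensor (M ⊗[A] N) (diag A M N C.Src x y) =
      diag A M N C.SrcSq (C.comulLin.lTensor M x) (C.comulLin.lTensor N y) := by
  induction x with
  | zero => simp
  | add x x' hx hx' => simp only [map_add, LinearMap.add_apply, hx, hx']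
  | tmul m k =>
    induction y with
    | zero => simp
    | add y y' hy hy' => simp only [map_add, hy, hy']
    | tmul n k' =>
      simp only [LinearMap.lTensor_tmul, diag_tmul]
      exact congrArg (fun z : C.SrcSq => (m ⊗ₜ[A] n) ⊗ₜ[A] z) (map_mul C.comul k k')

theorem append_diag {M N : Type*} [AddCommGroup M] [Module A M] [AddCommGroup N] [Module A N]
    (h h' : H) (x : M ⊗[A] C.Src) (y : N ⊗[A] C.Src) :
    (C.append (h * h')).lTensor (M ⊗[A] N) (diag A M N C.Src x y) =
      diag A M N C.SrcSq ((C.append h).lTensor M x) ((C.append h').lTensor N y) := by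
  induction x with
  | zero => simp
  | add x x' hx hx' => simp only [map_add, LinearMap.add_apply, hx, hx']
  | tmul m k =>
    induction y with
    | zero => simp
    | add y y' hy hy' => simp only [map_add, hy, hy']
    | tmul n k' =>
      simp only [LinearMap.lTensor_tmul, diag_tmul]
      refine congrArg (fun z : C.SrcSq => (m ⊗ₜ[A] n) ⊗ₜ[A] z) ?_
      exact (Algebra.TensorProduct.tmul_mul_tmul (R := A) (show C.Tgt from k) (show C.Tgt from k')
        (C.toSrc h) (C.toSrc h')).symm

theorem coactTensor_diag (M N : ProfComod C) (x : M ⊗[A] C.Src) (y : N ⊗[A] C.Src) :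
    C.coactTensor (tensorCoact M N) (tensorCoact_smul M N) (diag A M N C.Src x y) =
      diag A M N C.SrcSq (C.coactTensor M.coact M.coact_smul x)
        (C.coactTensor N.coact N.coact_smul y) := by
  induction x with
  | zero => simp
  | add x x' hx hx' => simp only [map_add, LinearMap.add_apply, hx, hx']
  | tmul m h =>
    induction y with
    | zero => simp
    | add y y' hy hy' => simp only [map_add, hy, hy']
    | tmul n k => exact append_diag (C := C) h k (M.coact m) (N.coact n)

theorem counit_diag {M N : Type*} [AddCommGroup M] [Module A M] [AddCommGroup N] [Module A N]
    (x : M ⊗[A] C.Src) (y : N ⊗[A] C.Src) :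
    TensorProduct.rid A (M ⊗[A] N) (C.counitLin.lTensor (M ⊗[A] N) (diag A M N C.Src x y)) =
      TensorProduct.rid A M (C.counitLin.lTensor M x) ⊗ₜ
        TensorProduct.rid A N (C.counitLin.lTensor N y) := by
  induction x with
  | zero => simp
  | add x x' hx hx' => simp only [map_add, LinearMap.add_apply, hx, hx', TensorProduct.add_tmul]
  | tmul m h =>
    induction y with
    | zero => simp
    | add y y' hy hy' => simp only [map_add, hy, hy', TensorProduct.tmul_add]
    | tmul n k =>
      simp only [LinearMap.lTensor_tmul, diag_tmul, TensorProduct.rid_tmul]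
      have e : C.counitLin (h * k) = C.counitLin h * C.counitLin k := map_mul C.counit h k
      rw [e, mul_smul, ← TensorProduct.tmul_smul, TensorProduct.smul_tmul']

/-- The tensor product of comodules. -/
def tensorObj (M N : ProfComod C) : ProfComod C where
  carrier := M ⊗[A] N
  coact := tensorCoact M N
  coact_smul := tensorCoact_smul M N
  coassoc z := by
    induction z with
    | zero => simp
    | add z z' hz hz' => simp only [map_add, hz, hz']
    | tmul m n =>
      rw [tensorCoact_tmul, comulLin_diag, M.coassoc, N.coassoc, coactTensor_diag]
  counit z := by
    induction z with
    | zero => simp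
    | add z z' hz hz' => simp only [map_add, hz, hz']
    | tmul m n => rw [tensorCoact_tmul, counit_diag, M.counit, N.counit]

/-- The coaction `a ↦ 1 ⊗ t(a)` on `A`. -/
def unitCoact (C : CommBialgebroidData R A H) : A →+ A ⊗[A] C.Src :=
  (TensorProduct.mk A A C.Src 1).toAddMonoidHom.comp ((C.t : A →+* H) : A →+ H)

theorem unitCoact_apply (a : A) : unitCoact C a = 1 ⊗ₜ (C.toSrc (C.t a)) := rfl

/-- The unit comodule. -/
def unitObj (C : CommBialgebroidData R A H) : ProfComod C where
  carrier := A
  coact := unitCoact C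
  coact_smul a b := by
    rw [unitCoact_apply, unitCoact_apply, LinearMap.lTensor_tmul, smul_eq_mul]
    exact congrArg (fun h : C.Src => (1 : A) ⊗ₜ[A] h) (map_mul C.t a b)
  coassoc a := by
    rw [unitCoact_apply, LinearMap.lTensor_tmul]
    change _ = (C.append (C.t a)).lTensor A (unitCoact C 1)
    rw [unitCoact_apply, LinearMap.lTensor_tmul]
    refine congrArg (fun h : C.SrcSq => (1 : A) ⊗ₜ[A] h) ((C.comul_t a).trans ?_)
    exact congrArg (fun x : C.Tgt => (x ⊗ₜ[A] (C.toSrc (C.t a)) : C.Tgt ⊗[A] C.Src))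
      (map_one C.t).symm
  counit a := by
    rw [unitCoact_apply, LinearMap.lTensor_tmul, TensorProduct.rid_tmul, smul_eq_mul, mul_one]
    exact C.counit_t a

theorem rTensor_diag {M M' N N' B : Type*} [AddCommGroup M] [Module A M] [AddCommGroup N]
    [Module A N] [AddCommGroup M'] [Module A M'] [AddCommGroup N'] [Module A N'] [CommRing B]
    [Algebra A B] (f : M →ₗ[A] M') (g : N →ₗ[A] N') (x : M ⊗[A] B) (y : N ⊗[A] B) :
    (TensorProduct.map f g).rTensor B (diag A M N B x y) =
      diag A M' N' B (f.rTensor B x) (g.rTensor B y) := by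
  induction x with
  | zero => simp
  | add x x' hx hx' => simp only [map_add, LinearMap.add_apply, hx, hx']
  | tmul m h =>
    induction y with
    | zero => simp
    | add y y' hy hy' => simp only [map_add, hy, hy']
    | tmul n k => simp

/-- The tensor product of morphisms. -/
def tensorHom {M M' N N' : ProfComod C} (f : M ⟶ M') (g : N ⟶ N') :
    tensorObj M N ⟶ tensorObj M' N' where
  hom := TensorProduct.map (Hom.lin f) (Hom.lin g)
  colinear z :=
    addHom_congr
      (((TensorProduct.map (Hom.lin f) (Hom.lin g)).rTensor C.Src).toAddMonoidHom.comp
        (tensorCoact M N))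
      ((tensorCoact M' N').comp (TensorProduct.map (Hom.lin f) (Hom.lin g)).toAddMonoidHom)
      (fun m n => (rTensor_diag (Hom.lin f) (Hom.lin g) (M.coact m) (N.coact n)).trans (by
        rw [lin_colinear, lin_colinear]; rfl)) z

theorem assoc_diag {M N L B : Type*} [AddCommGroup M] [Module A M] [AddCommGroup N] [Module A N]
    [AddCommGroup L] [Module A L] [CommRing B] [Algebra A B]
    (x : M ⊗[A] B) (y : N ⊗[A] B) (z : L ⊗[A] B) :
    (TensorProduct.assoc A M N L).toLinearMap.rTensor B
        (diag A (M ⊗[A] N) L B (diag A M N B x y) z) =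
      diag A M (N ⊗[A] L) B x (diag A N L B y z) := by
  induction x with
  | zero => simp
  | add x x' hx hx' => simp only [map_add, LinearMap.add_apply, hx, hx']
  | tmul m h =>
    induction y with
    | zero => simp
    | add y y' hy hy' => simp only [map_add, LinearMap.add_apply, hy, hy']
    | tmul n k =>
      induction z with
      | zero => simp
      | add z z' hz hz' => simp only [map_add, hz, hz']
      | tmul l k' => simp [mul_assoc]

/-- The associator. -/
def assocIso (M N L : ProfComod C) :
    tensorObj (tensorObj M N) L ≅ tensorObj M (tensorObj N L) :=
  isoMk (TensorProduct.assoc A M N L) fun z =>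
    addHom_congr₃ (A := A) (M := M) (N := N) (L := L) (X := (M ⊗[A] (N ⊗[A] L)) ⊗[A] C.Src)
      (((TensorProduct.assoc A M N L).toLinearMap.rTensor C.Src).toAddMonoidHom.comp
        (tensorCoact (tensorObj M N) L))
      ((tensorCoact M (tensorObj N L)).comp
        (TensorProduct.assoc A M N L).toLinearMap.toAddMonoidHom)
      (fun m n l => assoc_diag (M.coact m) (N.coact n) (L.coact l)) z

theorem comm_diag {M N B : Type*} [AddCommGroup M] [Module A M] [AddCommGroup N] [Module A N]
    [CommRing B] [Algebra A B] (x : M ⊗[A] B) (y : N ⊗[A] B) :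
    (TensorProduct.comm A M N).toLinearMap.rTensor B (diag A M N B x y) = diag A N M B y x := by
  induction x with
  | zero => simp
  | add x x' hx hx' => simp only [map_add, LinearMap.add_apply, hx, hx']
  | tmul m h =>
    induction y with
    | zero => simp
    | add y y' hy hy' => simp only [map_add, LinearMap.add_apply, hy, hy']
    | tmul n k => simp [mul_comm]

/-- The symmetry, which is the flip. -/
def braidIso (M N : ProfComod C) : tensorObj M N ≅ tensorObj N M :=
  isoMk (TensorProduct.comm A M N) fun z =>
    addHom_congr
      (((TensorProduct.comm A M N).toLinearMap.rTensor C.Src).toAddMonoidHom.comp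
        (tensorCoact M N))
      ((tensorCoact N M).comp (TensorProduct.comm A M N).toLinearMap.toAddMonoidHom)
      (fun m n => comm_diag (M.coact m) (N.coact n)) z

theorem lid_diag {N : Type*} [AddCommGroup N] [Module A N] (h : H) (y : N ⊗[A] C.Src) :
    (TensorProduct.lid A N).toLinearMap.rTensor C.Src
        (diag A A N C.Src (1 ⊗ₜ (C.toSrc h)) y) = (C.mulSrc h).lTensor N y := by
  induction y with
  | zero => simp
  | add y y' hy hy' => simp only [map_add, hy, hy']
  | tmul n k =>
    rw [diag_tmul, LinearMap.rTensor_tmul, LinearMap.lTensor_tmul, LinearEquiv.coe_coe,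
      TensorProduct.lid_tmul, one_smul]
    rfl

/-- The left unitor. -/
def leftUnitorIso (M : ProfComod C) : tensorObj (unitObj C) M ≅ M :=
  isoMk (TensorProduct.lid A M) fun z => by
    let ρ : A ⊗[A] M →+ (A ⊗[A] M) ⊗[A] C.Src := tensorCoact (unitObj C) M
    exact addHom_congr
      (((TensorProduct.lid A M).toLinearMap.rTensor C.Src).toAddMonoidHom.comp ρ)
      (M.coact.comp (TensorProduct.lid A M).toLinearMap.toAddMonoidHom)
      (fun a m => (lid_diag (C.t a) (M.coact m)).trans ((M.coact_smul a m).symm.trans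
        (congrArg M.coact (TensorProduct.lid_tmul m a).symm))) z

theorem rid_diag {N : Type*} [AddCommGroup N] [Module A N] (h : H) (y : N ⊗[A] C.Src) :
    (TensorProduct.rid A N).toLinearMap.rTensor C.Src
        (diag A N A C.Src y (1 ⊗ₜ (C.toSrc h))) = (C.mulSrc h).lTensor N y := by
  induction y with
  | zero => simp
  | add y y' hy hy' => simp only [map_add, LinearMap.add_apply, hy, hy']
  | tmul n k =>
    rw [diag_tmul, LinearMap.rTensor_tmul, LinearMap.lTensor_tmul, LinearEquiv.coe_coe,
      TensorProduct.rid_tmul, one_smul, mul_comm]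
    rfl

/-- The right unitor. -/
def rightUnitorIso (M : ProfComod C) : tensorObj M (unitObj C) ≅ M :=
  isoMk (TensorProduct.rid A M) fun z => by
    let ρ : M ⊗[A] A →+ (M ⊗[A] A) ⊗[A] C.Src := tensorCoact M (unitObj C)
    exact addHom_congr
      (((TensorProduct.rid A M).toLinearMap.rTensor C.Src).toAddMonoidHom.comp ρ)
      (M.coact.comp (TensorProduct.rid A M).toLinearMap.toAddMonoidHom)
      (fun m a => (rid_diag (C.t a) (M.coact m)).trans ((M.coact_smul a m).symm.trans
        (congrArg M.coact (TensorProduct.rid_tmul m a).symm))) z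

instance : MonoidalCategoryStruct (ProfComod C) where
  tensorObj := tensorObj
  whiskerLeft M _ _ f := tensorHom (𝟙 M) f
  whiskerRight f N := tensorHom f (𝟙 N)
  tensorHom := tensorHom
  tensorUnit := unitObj C
  associator := assocIso
  leftUnitor := leftUnitorIso
  rightUnitor := rightUnitorIso

/-- The forgetful functor strictly preserves the monoidal structure. -/
def forgetData : Monoidal.InducingFunctorData (forget C) where
  μIso _ _ := Iso.refl _
  εIso := Iso.refl _
  whiskerLeft_eq _ _ _ _ := ModuleCat.hom_ext (TensorProduct.ext' fun _ _ => rfl)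
  whiskerRight_eq _ _ := ModuleCat.hom_ext (TensorProduct.ext' fun _ _ => rfl)
  tensorHom_eq _ _ := ModuleCat.hom_ext (TensorProduct.ext' fun _ _ => rfl)
  associator_eq _ _ _ := ModuleCat.hom_ext (TensorProduct.ext_threefold fun _ _ _ => rfl)
  leftUnitor_eq _ := ModuleCat.hom_ext (TensorProduct.ext' fun _ _ => rfl)
  rightUnitor_eq _ := ModuleCat.hom_ext (TensorProduct.ext' fun _ _ => rfl)

instance : MonoidalCategory (ProfComod C) := Monoidal.induced (forget C) forgetData

instance : (forget C).Monoidal := Monoidal.fromInducedMonoidal (forget C) forgetData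

instance : BraidedCategory (ProfComod C) :=
  BraidedCategory.ofFaithful (forget C) braidIso fun _ _ =>
    ModuleCat.hom_ext (TensorProduct.ext' fun _ _ => rfl)

instance : SymmetricCategory (ProfComod C) where
  symmetry _ _ := hom_ext (TensorProduct.ext' fun _ _ => rfl)

end ProfComod

/-! ### The finite dual -/

section FinDual

variable (A : Type u) (U : Type v) [CommRing A] [Ring U] [Module A U] [ARing A U]

open scoped DirectSum

variable {A U} in
/-- The abelian group `P* ⊗ P`. -/
def Summand (P : ProfMod A U) : Type u := Module.Dual A P ⊗[ℤ] P

instance (P : ProfMod A U) : AddCommGroup (Summand P) :=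
  inferInstanceAs (AddCommGroup (Module.Dual A P ⊗[ℤ] P))

/-- The direct sum `⨁ P* ⊗ P` over all `A`-profinite right `U`-modules `P`. -/
abbrev PreDual : Type (max (u + 1) v) := ⨁ P : ProfMod A U, Summand P

open scoped Classical in
variable {A U} in
/-- The element `φ ⊗ p` of the summand indexed by `P`. -/
def preMk (P : ProfMod A U) (φ : Module.Dual A P) (p : P) : PreDual A U :=
  DirectSum.of Summand P (φ ⊗ₜ[ℤ] p)

/-- The subgroup generated by all `q* ⊗ t p - q* t ⊗ p` for morphisms `t : P → Q`.  For `P = Q` these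
are the relations that balance `P* ⊗ P` over the endomorphism ring of `P`. -/
def dualRel : AddSubgroup (PreDual A U) :=
  AddSubgroup.closure {x | ∃ (P Q : ProfMod A U) (t : P ⟶ Q) (φ : Module.Dual A Q) (p : P),
    x = preMk Q φ (ProfMod.Hom.lin t p) - preMk P (φ ∘ₗ ProfMod.Hom.lin t) p}

/-- The (right) finite dual `U°` of the `A`-ring `U`. -/
def FinDual : Type (max (u + 1) v) := PreDual A U ⧸ dualRel A U

instance : AddCommGroup (FinDual A U) := inferInstanceAs (AddCommGroup (PreDual A U ⧸ dualRel A U))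

namespace FinDual

variable {A U}

/-- The class of `φ ⊗ p` in the finite dual. -/
def mk (P : ProfMod A U) (φ : Module.Dual A P) (p : P) : FinDual A U :=
  QuotientAddGroup.mk (s := dualRel A U) (preMk P φ p)

theorem mk_lin {P Q : ProfMod A U} (t : P ⟶ Q) (φ : Module.Dual A Q) (p : P) :
    mk Q φ (ProfMod.Hom.lin t p) = mk P (φ ∘ₗ ProfMod.Hom.lin t) p := by
  exact QuotientAddGroup.eq_iff_sub_mem.2 (AddSubgroup.subset_closure ⟨P, Q, t, φ, p, rfl⟩)

theorem mk_add_left (P : ProfMod A U) (φ ψ : Module.Dual A P) (p : P) :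
    mk P (φ + ψ) p = mk P φ p + mk P ψ p := by
  have h : preMk P (φ + ψ) p = preMk P φ p + preMk P ψ p := by
    unfold preMk
    rw [TensorProduct.add_tmul]
    exact map_add _ _ _
  exact congrArg (QuotientAddGroup.mk (s := dualRel A U)) h

theorem mk_add_right (P : ProfMod A U) (φ : Module.Dual A P) (p q : P) :
    mk P φ (p + q) = mk P φ p + mk P φ q := by
  have h : preMk P φ (p + q) = preMk P φ p + preMk P φ q := by
    unfold preMk
    rw [TensorProduct.tmul_add]
    exact map_add _ _ _
  exact congrArg (QuotientAddGroup.mk (s := dualRel A U)) h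

/-- The biadditive map `(φ, p) ↦ φ ⊗ p`. -/
def mkHom (P : ProfMod A U) : Module.Dual A P →+ P →+ FinDual A U :=
  AddMonoidHom.mk' (fun φ => AddMonoidHom.mk' (mk P φ) (mk_add_right P φ))
    (fun φ ψ => by ext p; exact mk_add_left P φ ψ p)

theorem mk_sum_left (P : ProfMod A U) {ι : Type*} (s : Finset ι) (φ : ι → Module.Dual A P) (p : P) :
    mk P (∑ i ∈ s, φ i) p = ∑ i ∈ s, mk P (φ i) p := by
  change mkHom P _ p = ∑ i ∈ s, mkHom P (φ i) p
  simp

/-- The additive map on `P* ⊗ P` given by a biadditive map. -/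
def summandLift {G : Type*} [AddCommGroup G] {P : ProfMod A U} (b : Module.Dual A P →+ P →+ G) :
    Summand P →+ G :=
  TensorProduct.liftAddHom b (fun n φ p => by simp)

open scoped Classical in
/-- The additive map on the direct sum given by a family of biadditive maps. -/
def preLift {G : Type*} [AddCommGroup G] (b : ∀ P : ProfMod A U, Module.Dual A P →+ P →+ G) :
    PreDual A U →+ G :=
  DirectSum.toAddMonoid fun P => summandLift (b P)

theorem preLift_preMk {G : Type*} [AddCommGroup G]
    (b : ∀ P : ProfMod A U, Module.Dual A P →+ P →+ G) (P : ProfMod A U) (φ : Module.Dual A P)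
    (p : P) : preLift b (preMk P φ p) = b P φ p := by
  classical
  exact DirectSum.toAddMonoid_of (fun P : ProfMod A U => summandLift (b P)) P (φ ⊗ₜ[ℤ] p)

/-- Additive maps out of the finite dual. -/
def lift {G : Type*} [AddCommGroup G] (b : ∀ P : ProfMod A U, Module.Dual A P →+ P →+ G)
    (hb : ∀ (P Q : ProfMod A U) (t : P ⟶ Q) (φ : Module.Dual A Q) (p : P),
      b Q φ (ProfMod.Hom.lin t p) = b P (φ ∘ₗ ProfMod.Hom.lin t) p) : FinDual A U →+ G :=
  QuotientAddGroup.lift (dualRel A U) (preLift b)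
    ((AddSubgroup.closure_le _).2 (by
      rintro _ ⟨P, Q, t, φ, p, rfl⟩
      refine AddMonoidHom.mem_ker.2 ?_
      rw [map_sub, sub_eq_zero, preLift_preMk, preLift_preMk, hb]))

theorem lift_mk {G : Type*} [AddCommGroup G]
    (b : ∀ P : ProfMod A U, Module.Dual A P →+ P →+ G)
    (hb : ∀ (P Q : ProfMod A U) (t : P ⟶ Q) (φ : Module.Dual A Q) (p : P),
      b Q φ (ProfMod.Hom.lin t p) = b P (φ ∘ₗ ProfMod.Hom.lin t) p)
    (P : ProfMod A U) (φ : Module.Dual A P) (p : P) : lift b hb (mk P φ p) = b P φ p :=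
  preLift_preMk b P φ p

theorem induction_on {motive : FinDual A U → Prop} (x : FinDual A U) (zero : motive 0)
    (mk : ∀ P φ p, motive (mk P φ p)) (add : ∀ x y, motive x → motive y → motive (x + y)) :
    motive x := by
  classical
  obtain ⟨x, rfl⟩ := QuotientAddGroup.mk_surjective (s := dualRel A U) x
  induction x using DirectSum.induction_on with
  | zero => exact zero
  | of P z =>
    refine TensorProduct.induction_on (R := ℤ) z ?_ (fun φ p => mk P φ p) fun z z' hz hz' => ?_
    · have h := map_zero (DirectSum.of (Summand (A := A) (U := U)) P)
      exact (congrArg (fun y => motive (QuotientAddGroup.mk (s := dualRel A U) y)) h).mpr zero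
    · have h := map_add (DirectSum.of (Summand (A := A) (U := U)) P) z z'
      exact (congrArg (fun y => motive (QuotientAddGroup.mk (s := dualRel A U) y)) h).mpr
        (add _ _ hz hz')
  | add x y hx hy => exact add _ _ hx hy

theorem addHom_ext {G : Type*} [AddCommGroup G] {f g : FinDual A U →+ G}
    (h : ∀ P φ p, f (mk P φ p) = g (mk P φ p)) : f = g := by
  ext x
  induction x using induction_on with
  | zero => simp
  | mk P φ p => exact h P φ p
  | add x y hx hy => rw [map_add, map_add, hx, hy]

/-- The map `ζ : U° → U*`, `φ ⊗ p ↦ (u ↦ φ(p u))`. -/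
def zeta (A : Type u) (U : Type v) [CommRing A] [Ring U] [Module A U] [ARing A U] :
    FinDual A U →+ (U →ₗ[A] A) :=
  lift (fun P => AddMonoidHom.mk' (fun φ => AddMonoidHom.mk' (fun p => φ ∘ₗ P.orbit p)
        (fun p q => by rw [ProfMod.orbit_add, LinearMap.comp_add]))
      (fun φ ψ => by ext p u; rfl))
    (fun P Q t φ p => by
      ext u
      change φ (MulOpposite.op u • ProfMod.Hom.lin t p) =
        φ (ProfMod.Hom.lin t (MulOpposite.op u • p))
      rw [ProfMod.lin_op_smul])

theorem zeta_mk (P : ProfMod A U) (φ : Module.Dual A P) (p : P) (u : U) :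
    zeta A U (mk P φ p) u = φ (MulOpposite.op u • p) := by
  exact LinearMap.congr_fun (lift_mk _ _ P φ p) u

end FinDual

end FinDual

namespace FinDual

variable {A : Type u} {U : Type v} [CommRing A] [Ring U] [Module A U] [Coalgebra A U]
variable [CocommRightBialgebroid A U]

/-- `(φ ⋆ ψ)(x ⊗ y) = φ(x) ψ(y)`. -/
def star {P Q : ProfMod A U} (φ : Module.Dual A P) (ψ : Module.Dual A Q) :
    Module.Dual A (P ⊗ Q : ProfMod A U) :=
  LinearMap.mul' A A ∘ₗ TensorProduct.map φ ψ

/-- The element `x ⊗ y` of the tensor product of two right `U`-modules. -/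
def tmul {P Q : ProfMod A U} (p : P) (q : Q) : (P ⊗ Q : ProfMod A U) := p ⊗ₜ[A] q

theorem star_tmul {P Q : ProfMod A U} (φ : Module.Dual A P) (ψ : Module.Dual A Q) (p : P) (q : Q) :
    star φ ψ (tmul p q) = φ p * ψ q := rfl

/-- Equality of the classes of `φ ⊗ x` and `ψ ⊗ y` if a morphism carries `x` to `y` and `ψ` to `φ`. -/
theorem mk_eq_mk {P Q : ProfMod A U} (t : P ⟶ Q) {φ : Module.Dual A P} {ψ : Module.Dual A Q}
    {x : P} {y : Q} (hx : ProfMod.Hom.lin t x = y) (hφ : ψ ∘ₗ ProfMod.Hom.lin t = φ) :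
    mk P φ x = mk Q ψ y := by
  subst hx hφ
  exact (mk_lin t ψ x).symm

theorem mk_star_add_left (P Q : ProfMod A U) (ψ ψ' : Module.Dual A Q) (φ : Module.Dual A P) (p : P)
    (q : Q) : mk (Q ⊗ P) (star (ψ + ψ') φ) (tmul q p) =
      mk (Q ⊗ P) (star ψ φ) (tmul q p) + mk (Q ⊗ P) (star ψ' φ) (tmul q p) := by
  have h : star (ψ + ψ') φ = star ψ φ + star ψ' φ := TensorProduct.ext' fun x y => by
    change (ψ x + ψ' x) * φ y = ψ x * φ y + ψ' x * φ y
    rw [add_mul]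
  rw [h, mk_add_left]

theorem mk_star_add_right (P Q : ProfMod A U) (ψ : Module.Dual A Q) (φ φ' : Module.Dual A P) (p : P)
    (q : Q) : mk (Q ⊗ P) (star ψ (φ + φ')) (tmul q p) =
      mk (Q ⊗ P) (star ψ φ) (tmul q p) + mk (Q ⊗ P) (star ψ φ') (tmul q p) := by
  have h : star ψ (φ + φ') = star ψ φ + star ψ φ' := TensorProduct.ext' fun x y => by
    change ψ x * (φ y + φ' y) = ψ x * φ y + ψ x * φ' y
    rw [mul_add]
  rw [h, mk_add_left]

theorem mk_tmul_add_left (P Q : ProfMod A U) (ψ : Module.Dual A Q) (φ : Module.Dual A P) (p : P)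
    (q q' : Q) : mk (Q ⊗ P) (star ψ φ) (tmul (q + q') p) =
      mk (Q ⊗ P) (star ψ φ) (tmul q p) + mk (Q ⊗ P) (star ψ φ) (tmul q' p) := by
  have h : (tmul (q + q') p : (Q ⊗ P : ProfMod A U)) = tmul q p + tmul q' p :=
    TensorProduct.add_tmul q q' p
  rw [h, mk_add_right]

theorem mk_tmul_add_right (P Q : ProfMod A U) (ψ : Module.Dual A Q) (φ : Module.Dual A P)
    (p p' : P) (q : Q) : mk (Q ⊗ P) (star ψ φ) (tmul q (p + p')) =
      mk (Q ⊗ P) (star ψ φ) (tmul q p) + mk (Q ⊗ P) (star ψ φ) (tmul q p') := by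
  have h : (tmul q (p + p') : (Q ⊗ P : ProfMod A U)) = tmul q p + tmul q p' :=
    TensorProduct.tmul_add q p p'
  rw [h, mk_add_right]

/-- The map `y ↦ (φ ⊗ p) y`. -/
def mulMk (P : ProfMod A U) (φ : Module.Dual A P) (p : P) : FinDual A U →+ FinDual A U :=
  lift (fun Q => AddMonoidHom.mk' (fun ψ => AddMonoidHom.mk'
      (fun q => mk (Q ⊗ P) (star ψ φ) (tmul q p)) (mk_tmul_add_left P Q ψ φ p))
      (fun ψ ψ' => AddMonoidHom.ext (mk_star_add_left P Q ψ ψ' φ p)))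
    (fun _ _ t ψ q => (mk_eq_mk (x := tmul q p) (y := tmul (ProfMod.Hom.lin t q) p)
      (φ := star (ψ ∘ₗ ProfMod.Hom.lin t) φ) (ψ := star ψ φ) (t ▷ P) rfl
      (TensorProduct.ext' fun _ _ => rfl)).symm)

theorem mulMk_mk (P Q : ProfMod A U) (φ : Module.Dual A P) (p : P) (ψ : Module.Dual A Q) (q : Q) :
    mulMk P φ p (mk Q ψ q) = mk (Q ⊗ P) (star ψ φ) (tmul q p) := lift_mk _ _ Q ψ q

/-- The multiplication `(φ ⊗ p)(ψ ⊗ q) = (ψ ⋆ φ) ⊗ (q ⊗ p)`. -/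
def mulHom : FinDual A U →+ FinDual A U →+ FinDual A U :=
  lift (fun P => AddMonoidHom.mk' (fun φ => AddMonoidHom.mk' (mulMk P φ)
        (fun p p' => addHom_ext fun Q ψ q => by
          rw [AddMonoidHom.add_apply, mulMk_mk, mulMk_mk, mulMk_mk, mk_tmul_add_right]))
      (fun φ φ' => AddMonoidHom.ext fun p => addHom_ext fun Q ψ q => by
        change mulMk P (φ + φ') p (mk Q ψ q) = mulMk P φ p (mk Q ψ q) + mulMk P φ' p (mk Q ψ q)
        rw [mulMk_mk, mulMk_mk, mulMk_mk, mk_star_add_right]))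
    (fun P P' t φ p => addHom_ext fun Q ψ q => by
      change mulMk P' φ (ProfMod.Hom.lin t p) (mk Q ψ q) =
        mulMk P (φ ∘ₗ ProfMod.Hom.lin t) p (mk Q ψ q)
      rw [mulMk_mk, mulMk_mk]
      exact (mk_eq_mk (x := tmul q p) (y := tmul q (ProfMod.Hom.lin t p))
        (φ := star ψ (φ ∘ₗ ProfMod.Hom.lin t)) (ψ := star ψ φ) (Q ◁ t) rfl
        (TensorProduct.ext' fun _ _ => rfl)).symm)

theorem mulHom_mk (P Q : ProfMod A U) (φ : Module.Dual A P) (p : P) (ψ : Module.Dual A Q) (q : Q) :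
    mulHom (mk P φ p) (mk Q ψ q) = mk (Q ⊗ P) (star ψ φ) (tmul q p) :=
  (DFunLike.congr_fun (lift_mk _ _ P φ p) (mk Q ψ q)).trans (mulMk_mk P Q φ p ψ q)

theorem mulHom_comm (x y : FinDual A U) : mulHom x y = mulHom y x := by
  induction x using induction_on with
  | zero => simp
  | add x x' hx hx' => simp only [map_add, AddMonoidHom.add_apply, hx, hx']
  | mk P φ p =>
    induction y using induction_on with
    | zero => simp
    | add y y' hy hy' => simp only [map_add, AddMonoidHom.add_apply, hy, hy']
    | mk Q ψ q =>
      rw [mulHom_mk, mulHom_mk]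
      exact mk_eq_mk (β_ Q P).hom rfl (TensorProduct.ext' fun x y => mul_comm (φ y) (ψ x))

theorem mulHom_assoc (x y z : FinDual A U) : mulHom (mulHom x y) z = mulHom x (mulHom y z) := by
  induction x using induction_on with
  | zero => simp
  | add x x' hx hx' => simp only [map_add, AddMonoidHom.add_apply, hx, hx']
  | mk P φ p =>
    induction y using induction_on with
    | zero => simp
    | add y y' hy hy' => simp only [map_add, AddMonoidHom.add_apply, hy, hy']
    | mk Q ψ q =>
      induction z using induction_on with
      | zero => simp
      | add z z' hz hz' => simp only [map_add, hz, hz']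
      | mk L χ l =>
        rw [mulHom_mk, mulHom_mk, mulHom_mk, mulHom_mk]
        exact (mk_eq_mk (x := tmul (tmul l q) p) (y := tmul l (tmul q p))
          (φ := star (star χ ψ) φ) (ψ := star χ (star ψ φ)) (α_ L Q P).hom rfl
          (TensorProduct.ext_threefold fun x y z => (mul_assoc (χ x) (ψ y) (φ z)).symm)).symm

/-- The element `l_a ⊗ b` for the unit object `A`, with `l_a` the multiplication by `a`. -/
def unitMk (a b : A) : FinDual A U :=
  mk (𝟙_ (ProfMod A U)) (show Module.Dual A A from LinearMap.mulLeft A a) (show A from b)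

theorem unitMk_mul_mk (a b : A) (P : ProfMod A U) (φ : Module.Dual A P) (p : P) :
    mulHom (unitMk a b) (mk P φ p) = mk P (a • φ) (b • p) := by
  refine (mulHom_mk _ P _ _ φ p).trans ?_
  refine mk_eq_mk (ρ_ P).hom (TensorProduct.rid_tmul (R := A) p b)
    (TensorProduct.ext' fun x c => ?_)
  change a • φ (TensorProduct.rid A P (x ⊗ₜ[A] (show A from c))) = φ x * (a * (show A from c))
  rw [TensorProduct.rid_tmul, map_smul, smul_eq_mul, smul_eq_mul]
  ring

instance : Mul (FinDual A U) := ⟨fun x y => mulHom x y⟩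

instance : One (FinDual A U) := ⟨unitMk 1 1⟩

theorem mk_mul_mk (P Q : ProfMod A U) (φ : Module.Dual A P) (p : P) (ψ : Module.Dual A Q) (q : Q) :
    mk P φ p * mk Q ψ q = mk (Q ⊗ P) (star ψ φ) (tmul q p) := mulHom_mk P Q φ p ψ q

theorem unitMk_mul (a b : A) (P : ProfMod A U) (φ : Module.Dual A P) (p : P) :
    unitMk a b * mk P φ p = mk P (a • φ) (b • p) := unitMk_mul_mk a b P φ p

protected theorem one_mul' (x : FinDual A U) : 1 * x = x := by
  change mulHom (unitMk 1 1) x = x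
  induction x using induction_on with
  | zero => simp
  | add x x' hx hx' => rw [map_add, hx, hx']
  | mk P φ p => rw [unitMk_mul_mk, one_smul, one_smul]

/-- The ring structure on the finite dual. -/
instance : CommRing (FinDual A U) :=
  { (inferInstance : AddCommGroup (FinDual A U)), (inferInstance : Mul (FinDual A U)),
    (inferInstance : One (FinDual A U)) with
    left_distrib := fun x y z => map_add (mulHom x) y z
    right_distrib := fun x y z => by
      change mulHom (x + y) z = mulHom x z + mulHom y z
      rw [map_add]; rfl
    zero_mul := fun x => by change mulHom 0 x = 0; rw [map_zero]; rfl
    mul_zero := fun x => map_zero (mulHom x)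
    mul_assoc := mulHom_assoc
    mul_comm := mulHom_comm
    one_mul := FinDual.one_mul'
    mul_one := fun x => (mulHom_comm x 1).trans (FinDual.one_mul' x) }

theorem unitMk_mul_unitMk (a b a' b' : A) :
    (unitMk a b * unitMk a' b' : FinDual A U) = unitMk (a * a') (b * b') := by
  refine (unitMk_mul a b _ _ _).trans ?_
  refine congrArg (fun φ : Module.Dual A A =>
    mk (𝟙_ (ProfMod A U)) φ (show A from b * b')) (LinearMap.ext fun c => ?_)
  exact (mul_assoc a a' c).symm

/-- The source map `a ↦ l_a ⊗ 1` of the finite dual. -/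
def src (A : Type u) (U : Type v) [CommRing A] [Ring U] [Module A U] [Coalgebra A U]
    [CocommRightBialgebroid A U] : A →+* FinDual A U where
  toFun a := unitMk a 1
  map_one' := rfl
  map_mul' a b := by rw [unitMk_mul_unitMk, mul_one]
  map_zero' := by
    refine (congrArg (fun φ : Module.Dual A A => mk (𝟙_ (ProfMod A U)) φ (1 : A))
      (LinearMap.mulLeft_zero_eq_zero A A)).trans ?_
    exact map_zero ((mkHom (𝟙_ (ProfMod A U))).flip (show A from 1))
  map_add' a b := by
    refine (congrArg (fun φ : Module.Dual A A => mk (𝟙_ (ProfMod A U)) φ (1 : A))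
      (?_ : LinearMap.mulLeft A (a + b) = LinearMap.mulLeft A a + LinearMap.mulLeft A b)).trans ?_
    · ext; simp
    · exact mk_add_left (𝟙_ (ProfMod A U)) _ _ _

/-- The target map `a ↦ id ⊗ a` of the finite dual. -/
def tgt (A : Type u) (U : Type v) [CommRing A] [Ring U] [Module A U] [Coalgebra A U]
    [CocommRightBialgebroid A U] : A →+* FinDual A U where
  toFun a := unitMk 1 a
  map_one' := rfl
  map_mul' a b := by rw [unitMk_mul_unitMk, mul_one]
  map_zero' := map_zero (mkHom (𝟙_ (ProfMod A U)) (show Module.Dual A A from LinearMap.mulLeft A 1))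
  map_add' a b := mk_add_right (𝟙_ (ProfMod A U)) _ _ _

theorem src_mul_mk (a : A) (P : ProfMod A U) (φ : Module.Dual A P) (p : P) :
    src A U a * mk P φ p = mk P (a • φ) p := by
  refine (unitMk_mul a 1 P φ p).trans ?_
  rw [one_smul]

theorem tgt_mul_mk (a : A) (P : ProfMod A U) (φ : Module.Dual A P) (p : P) :
    tgt A U a * mk P φ p = mk P φ (a • p) := by
  refine (unitMk_mul 1 a P φ p).trans ?_
  rw [one_smul]

end FinDual

section UnitEnd

variable (K : Type*) (A : Type u) (U : Type v) [CommRing K] [CommRing A] [Ring U] [Algebra K A]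
  [Algebra K U] [Module A U] [IsScalarTower K A U] [Coalgebra A U] [CocommRightBialgebroid A U]

/-- The `K`-subalgebra `T_A = {a ∈ A | a ε(u) = ε(s(a) u) for all u}` of `A`; it is the endomorphism
algebra of the right `U`-module `A`. -/
def unitEnd : Subalgebra K A where
  carrier := {a | ∀ u : U, a * Coalgebra.counit u = Coalgebra.counit (R := A) (ARing.s a * u)}
  mul_mem' {a b} ha hb u := by
    rw [mul_assoc, hb u, ha (ARing.s b * u), map_mul ARing.s, mul_assoc]
  add_mem' {a b} ha hb u := by
    rw [add_mul, ha u, hb u, map_add ARing.s, add_mul, map_add]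
  algebraMap_mem' r u := by
    have h : (ARing.s (algebraMap K A r) : U) = algebraMap K U r := by
      rw [s_eq, algebraMap_smul, Algebra.algebraMap_eq_smul_one]
    have h2 : (ARing.s (algebraMap K A r) : U) * u = (algebraMap K A r) • u := by
      rw [ARing.smul_eq, h, Algebra.commutes]
    rw [h2, map_smul, smul_eq_mul]

/-- The finite dual is an algebra over `T_A` through the source. -/
instance : Algebra (unitEnd K A U) (FinDual A U) :=
  ((FinDual.src A U).comp (algebraMap (unitEnd K A U) A)).toAlgebra

end UnitEnd

/-- A finite dual basis of an `A`-module. -/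
def IsDualBasis {A M : Type*} [CommRing A] [AddCommGroup M] [Module A M] {n : ℕ} (e : Fin n → M)
    (e' : Fin n → Module.Dual A M) : Prop :=
  ∀ x : M, ∑ i, e' i x • e i = x

theorem exists_dualBasis (A M : Type*) [CommRing A] [AddCommGroup M] [Module A M]
    [Module.Finite A M] [Module.Projective A M] :
    ∃ (n : ℕ) (e : Fin n → M) (e' : Fin n → Module.Dual A M), IsDualBasis e e' := by
  obtain ⟨n, f, g, -, -, hfg⟩ := Module.Finite.exists_comp_eq_id_of_projective A M
  refine ⟨n, fun i => f (Pi.single i 1), fun i => LinearMap.proj i ∘ₗ g, fun x => ?_⟩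
  have h : g x = ∑ i, g x i • (Pi.single i 1 : Fin n → A) := by
    ext j; simp [Finset.sum_apply, Pi.single_apply]
  conv_rhs => rw [← LinearMap.id_apply (R := A) x, ← hfg, LinearMap.comp_apply, h, map_sum]
  simp

section Chi

variable {K : Type*} {A : Type u} {U : Type v} [CommRing K] [CommRing A] [Ring U] [Algebra K A]
  [Algebra K U] [Module A U] [IsScalarTower K A U] [Coalgebra A U] [CocommRightBialgebroid A U]

/-- The source, target, counit and comultiplication are the canonical ones of the finite dual. -/
structure IsFinDual (C : CommBialgebroidData (unitEnd K A U) A (FinDual A U)) : Prop where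
  /-- `s°(a) = l_a ⊗ 1` -/
  source : ∀ a, C.s a = FinDual.src A U a
  /-- `t°(a) = id ⊗ a` -/
  target : ∀ a, C.t a = FinDual.tgt A U a
  /-- `ε°(φ ⊗ p) = φ(p)` -/
  counit : ∀ (P : ProfMod A U) (φ : Module.Dual A P) (p : P), C.counit (FinDual.mk P φ p) = φ p
  /-- `Δ°(φ ⊗ p) = ∑ (φ ⊗ eᵢ) ⊗ (eᵢ* ⊗ p)` for any dual basis `eᵢ, eᵢ*` of `P` -/
  comul : ∀ (P : ProfMod A U) (φ : Module.Dual A P) (p : P) (n : ℕ) (e : Fin n → P)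
    (e' : Fin n → Module.Dual A P), IsDualBasis e e' →
      C.comul (FinDual.mk P φ p) =
        ∑ i, C.toTgt (FinDual.mk P φ (e i)) ⊗ₜ C.toSrc (FinDual.mk P (e' i) p)

variable (C : CommBialgebroidData (unitEnd K A U) A (FinDual A U))

/-- The map `p ↦ ∑ eᵢ ⊗ (eᵢ* ⊗ p)` for elements `eᵢ` and linear forms `eᵢ*`. -/
def preCoact (P : ProfMod A U) {n : ℕ} (e : Fin n → P) (e' : Fin n → Module.Dual A P) :
    P →+ P ⊗[A] C.Src :=
  AddMonoidHom.mk' (fun p => ∑ i, e i ⊗ₜ C.toSrc (FinDual.mk P (e' i) p)) fun p q => by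
    simp only [FinDual.mk_add_right, map_add, TensorProduct.tmul_add, Finset.sum_add_distrib]

theorem preCoact_apply (P : ProfMod A U) {n : ℕ} (e : Fin n → P) (e' : Fin n → Module.Dual A P)
    (p : P) : preCoact C P e e' p = ∑ i, e i ⊗ₜ C.toSrc (FinDual.mk P (e' i) p) := rfl

variable {C}

theorem preCoact_lin (hC : IsFinDual C) {P Q : ProfMod A U} (t : P ⟶ Q) {n m : ℕ} (e : Fin n → P)
    (e' : Fin n → Module.Dual A P) (he : IsDualBasis e e') (d : Fin m → Q)
    (d' : Fin m → Module.Dual A Q) (hd : IsDualBasis d d') (p : P) :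
    (ProfMod.Hom.lin t).rTensor C.Src (preCoact C P e e' p) =
      preCoact C Q d d' (ProfMod.Hom.lin t p) := by
  have h₁ : ∀ i, ProfMod.Hom.lin t (e i) ⊗ₜ[A] C.toSrc (FinDual.mk P (e' i) p) =
      ∑ j, d j ⊗ₜ[A] C.toSrc (FinDual.mk P (d' j (ProfMod.Hom.lin t (e i)) • e' i) p) := fun i => by
    conv_lhs => rw [← hd (ProfMod.Hom.lin t (e i)), TensorProduct.sum_tmul]
    refine Finset.sum_congr rfl fun j _ => ?_
    rw [TensorProduct.smul_tmul, via_smul]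
    refine congrArg (fun x : FinDual A U => d j ⊗ₜ[A] C.toSrc x) ?_
    exact (congrArg (· * FinDual.mk P (e' i) p) (hC.source _)).trans (FinDual.src_mul_mk _ _ _ _)
  rw [preCoact_apply, preCoact_apply, map_sum]
  simp only [LinearMap.rTensor_tmul]
  rw [Finset.sum_congr rfl fun i _ => h₁ i, Finset.sum_comm]
  refine Finset.sum_congr rfl fun j _ => ?_
  rw [← TensorProduct.tmul_sum, ← map_sum, ← FinDual.mk_sum_left, FinDual.mk_lin]
  congr 3
  ext x
  conv_rhs => rw [LinearMap.comp_apply, ← he x, map_sum, map_sum]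
  simp [mul_comm]

theorem preCoact_eq (hC : IsFinDual C) (P : ProfMod A U) {n m : ℕ} (e : Fin n → P)
    (e' : Fin n → Module.Dual A P) (he : IsDualBasis e e') (d : Fin m → P)
    (d' : Fin m → Module.Dual A P) (hd : IsDualBasis d d') :
    preCoact C P e e' = preCoact C P d d' := by
  ext p
  have h := preCoact_lin hC (𝟙 P) e e' he d d' hd p
  have h' : ProfMod.Hom.lin (𝟙 P) = LinearMap.id := rfl
  rwa [h', LinearMap.rTensor_id, LinearMap.id_apply, LinearMap.id_apply] at h

/-- The coaction `χ_P : P → P ⊗_A U°`, `p ↦ ∑ eᵢ ⊗ (eᵢ* ⊗ p)`, for a chosen finite dual basis of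
`P`. -/
def chiCoact (C : CommBialgebroidData (unitEnd K A U) A (FinDual A U)) (P : ProfMod A U) :
    P →+ P ⊗[A] C.Src :=
  preCoact C P (exists_dualBasis A P).choose_spec.choose
    (exists_dualBasis A P).choose_spec.choose_spec.choose

theorem chiCoact_eq (hC : IsFinDual C) (P : ProfMod A U) {n : ℕ} (e : Fin n → P)
    (e' : Fin n → Module.Dual A P) (he : IsDualBasis e e') :
    chiCoact C P = preCoact C P e e' :=
  preCoact_eq hC P _ _ (exists_dualBasis A P).choose_spec.choose_spec.choose_spec _ _ he

theorem chiCoact_smul (hC : IsFinDual C) (P : ProfMod A U) (a : A) (p : P) :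
    chiCoact C P (a • p) = (C.mulSrc (C.t a)).lTensor P (chiCoact C P p) := by
  obtain ⟨n, e, e', he⟩ := exists_dualBasis A P
  rw [chiCoact_eq hC P e e' he, preCoact_apply, preCoact_apply, map_sum]
  refine Finset.sum_congr rfl fun i _ => ?_
  rw [LinearMap.lTensor_tmul, CommBialgebroidData.mulSrc_apply, ← map_mul, hC.target,
    FinDual.tgt_mul_mk]

/-- The comodule `χ(P)`. -/
def chiObj (C : CommBialgebroidData (unitEnd K A U) A (FinDual A U)) (hC : IsFinDual C)
    (P : ProfMod A U) : ProfComod C where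
  carrier := P
  coact := chiCoact C P
  coact_smul := chiCoact_smul hC P
  coassoc p := by
    obtain ⟨n, e, e', he⟩ := exists_dualBasis A P
    have h : ∀ p, chiCoact C P p = ∑ i, e i ⊗ₜ C.toSrc (FinDual.mk P (e' i) p) := fun p => by
      rw [chiCoact_eq hC P e e' he, preCoact_apply]
    rw [h, map_sum, map_sum]
    have h₁ : ∀ i, C.comulLin.lTensor P (e i ⊗ₜ[A] C.toSrc (FinDual.mk P (e' i) p)) =
        ∑ j, e i ⊗ₜ[A] C.append (FinDual.mk P (e' j) p) (C.toSrc (FinDual.mk P (e' i) (e j))) :=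
      fun i => by
        rw [LinearMap.lTensor_tmul, ← TensorProduct.tmul_sum]
        exact congrArg (fun z : C.SrcSq => e i ⊗ₜ[A] z) (hC.comul P (e' i) p n e e' he)
    have h₂ : ∀ j, C.coactTensor (chiCoact C P) (chiCoact_smul hC P)
        (e j ⊗ₜ[A] C.toSrc (FinDual.mk P (e' j) p)) =
        ∑ i, e i ⊗ₜ[A] C.append (FinDual.mk P (e' j) p) (C.toSrc (FinDual.mk P (e' i) (e j))) :=
      fun j => by
        change (C.append (FinDual.mk P (e' j) p)).lTensor P (chiCoact C P (e j)) = _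
        rw [h, map_sum]
        simp only [LinearMap.lTensor_tmul]
    rw [Finset.sum_congr rfl fun i _ => h₁ i, Finset.sum_congr rfl fun i _ => h₂ i,
      Finset.sum_comm]
  counit p := by
    obtain ⟨n, e, e', he⟩ := exists_dualBasis A P
    rw [chiCoact_eq hC P e e' he, preCoact_apply, map_sum, map_sum]
    conv_rhs => rw [← he p]
    refine Finset.sum_congr rfl fun i _ => ?_
    rw [LinearMap.lTensor_tmul, TensorProduct.rid_tmul]
    exact congrArg (fun a : A => a • e i) (hC.counit P (e' i) p)

/-- The functor `χ` from `A`-profinite right `U`-modules to `A`-profinite right `U°`-comodules; it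
is the identity on underlying `A`-modules and linear maps. -/
def chi (C : CommBialgebroidData (unitEnd K A U) A (FinDual A U)) (hC : IsFinDual C) :
    ProfMod A U ⥤ ProfComod C where
  obj := chiObj C hC
  map {P Q} t :=
    { hom := ProfMod.Hom.lin t
      colinear := fun p => by
        obtain ⟨n, e, e', he⟩ := exists_dualBasis A P
        obtain ⟨m, d, d', hd⟩ := exists_dualBasis A Q
        change (ProfMod.Hom.lin t).rTensor C.Src (chiCoact C P p) =
          chiCoact C Q (ProfMod.Hom.lin t p)
        rw [chiCoact_eq hC P e e' he, chiCoact_eq hC Q d d' hd]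
        exact preCoact_lin hC t e e' he d d' hd p }

end Chi

/-- A monoidal functor is strict if it commutes with unit and tensor product on objects and its
structure isomorphisms are identities. -/
structure IsStrictMonoidal {C D : Type*} [Category* C] [Category* D] [MonoidalCategory C]
    [MonoidalCategory D] (F : C ⥤ D) [F.Monoidal] : Prop where
  unit_eq : 𝟙_ D = F.obj (𝟙_ C)
  ε_eq : Functor.LaxMonoidal.ε F = eqToHom unit_eq
  tensor_eq : ∀ X Y : C, F.obj X ⊗ F.obj Y = F.obj (X ⊗ Y)
  μ_eq : ∀ X Y : C, Functor.LaxMonoidal.μ F X Y = eqToHom (tensor_eq X Y)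

end HopfDual

end

open HopfDual CategoryTheory

/-!
# The finite dual of a cocommutative right Hopf algebroid

The class of `φ ⊗ p` in the finite dual only depends on `(P, φ, p)` up to morphisms of
`A`-profinite right `U`-modules, so every identity between such classes is proved by exhibiting a
morphism, or by expanding along a dual basis.

Comultiplication and counit are defined on representatives. That `Δ°` depends neither on the dual
basis nor on the representative is the single computation `FinDual.comulMk_lin`. Coassociativity
and the counit laws are then dual basis computations.

The bijectivity of the canonical map `β` is needed for the antipode only. It yields the action of
`U` on the dual module `P*`: there is a unique additive map on `U ⊗ U` with
`x u₁ ⊗ u₂ ↦ φ(p x) · u` (`ProfMod.pairing`), and its value at `1 ⊗ u` is `(φ u)(p)`. Since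
additive maps on `U ⊗ U` are determined by their values at the elements `x u₁ ⊗ u₂`, the module
axioms, the linearity of the evaluation `P ⊗ P* → A` and its universal property
(`ProfMod.homDual`: a morphism `P ⊗ M → A` is a morphism `M → P*`) are checked on those elements.
The antipode is `φ ⊗ p ↦ ev_p ⊗ φ`. Each of its properties follows from a pairing in the symmetric
monoidal category of modules (`FinDual.dualMk_eq_mk`): multiplicativity from
`(Q ⊗ P) ⊗ (Q* ⊗ P*) → A`, involutivity from `P* ⊗ P → A`, and `S(h₁) h₂ = t(ε(h))` from the
evaluation itself. The other antipode law is the first one for `P*`, to which `S` is applied.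

The functor `χ` is the identity on underlying modules, and the two coactions on `P ⊗ Q` agree
because the tensor product of dual bases is a dual basis; so `χ` is strict monoidal, with identity
maps as structure isomorphisms.

A comodule `M` carries the action `m u = ζ(m₁)(u) m₀`; it is associative because
`ζ(h)(u v) = ζ(h₁)(s(ζ(h₂)(u)) v)`. This defines a left inverse of `χ`. If `ζ` is injective, then
an element of `M ⊗ U°`, for `M` finitely generated and projective, is determined by its evaluations
in `M` at all `u ∈ U` (`ext_of_evalZeta`), so the coaction of `M` is recovered from the action and
the inverse is two-sided. Its strict monoidality is inherited from `χ`.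
-/

noncomputable section

namespace HopfDual

universe v u

/-! ### Dual modules of a cocommutative right Hopf algebroid -/

section Canonical

variable {A : Type u} {U : Type v} [CommRing A] [Ring U] [Module A U] [Coalgebra A U]

theorem lmul₂_lmul₂ [CocommRightBialgebroid A U] (x y x' y' : U) (z : U ⊗[A] U) :
    lmul₂ A x y (lmul₂ A x' y' z) = lmul₂ A (x * x') (y * y') z := by
  induction z with
  | zero => simp
  | add z z' h h' => simp only [map_add, h, h']
  | tmul p q => simp [lmul₂, mul_assoc]

theorem lmul₂_one_one [CocommRightBialgebroid A U] (z : U ⊗[A] U) : lmul₂ A 1 1 z = z := by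
  induction z with
  | zero => simp
  | add z z' h h' => simp only [map_add, h, h']
  | tmul p q => simp [lmul₂]

section Bialgebroid

variable [CocommRightBialgebroid A U]

/-- The map `z ↦ z Δ(v)` on `U ⊗[A] U`, well defined because `Δ(v)` lies in the Takeuchi product. -/
def mulComul (v : U) : U ⊗[A] U →+ U ⊗[A] U :=
  TensorProduct.liftAddHom
    (AddMonoidHom.mk' (fun x : U => AddMonoidHom.mk'
        (fun y : U => lmul₂ A x y (Coalgebra.comul v))
        (fun y y' => by
          have h : lmul A (y + y') = lmul A y + lmul A y' := by ext v; simp [add_mul]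
          simp [lmul₂, h, TensorProduct.map_add_right]))
      (fun x x' => by
        ext y
        have h : lmul A (x + x') = lmul A x + lmul A x' := by ext v; simp [add_mul]
        simp [lmul₂, h, TensorProduct.map_add_left]))
    (fun a x y => by
      have h := congrArg (lmul₂ A x y) (CocommRightBialgebroid.takeuchi a v)
      have h₁ : lmul₂ A (a • x) y (Coalgebra.comul v) =
          lmul₂ A x y ((lmul A (ARing.s a)).rTensor U (Coalgebra.comul v)) := by
        have : (lmul A (ARing.s a)).rTensor U = lmul₂ A (ARing.s a : U) 1 :=
          TensorProduct.ext' fun p q => by simp [lmul₂]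
        rw [this, lmul₂_lmul₂, mul_one, ARing.smul_eq]
      have h₂ : lmul₂ A x (a • y) (Coalgebra.comul v) =
          lmul₂ A x y ((lmul A (ARing.s a)).lTensor U (Coalgebra.comul v)) := by
        have : (lmul A (ARing.s a)).lTensor U = lmul₂ A 1 (ARing.s a : U) :=
          TensorProduct.ext' fun p q => by simp [lmul₂]
        rw [this, lmul₂_lmul₂, mul_one, ARing.smul_eq]
      exact h₁.trans (h.trans h₂.symm))

theorem mulComul_tmul (v x y : U) :
    mulComul v (x ⊗ₜ[A] y) = lmul₂ A x y (Coalgebra.comul v) := rfl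

theorem mulComul_comul (u v : U) :
    mulComul v (Coalgebra.comul (R := A) u) = Coalgebra.comul (u * v) := by
  obtain ⟨n, x, y, h⟩ := exists_repr (Coalgebra.comul (R := A) u)
  rw [CocommRightBialgebroid.comul_mul u v n x y h, h, map_sum]
  rfl

theorem mulComul_lmul₂ (v x y : U) (z : U ⊗[A] U) :
    mulComul v (lmul₂ A x y z) = lmul₂ A x y (mulComul v z) := by
  induction z with
  | zero => simp
  | add z z' h h' => simp only [map_add, h, h']
  | tmul p q => rw [mulComul_tmul, lmul₂_lmul₂]; rfl

end Bialgebroid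

variable [CocommRightHopfAlgebroid A U]

/-- Additive maps on `U ⊗[A] U` are determined by their values on the elements `x u₁ ⊗ u₂`: this is
the surjectivity of the canonical map. -/
theorem addHom_ext_canonical {X : Type*} [AddCommGroup X] (f g : U ⊗[A] U →+ X)
    (h : ∀ x u : U, f (lmul₂ A x 1 (Coalgebra.comul u)) = g (lmul₂ A x 1 (Coalgebra.comul u)))
    (z : U ⊗[A] U) : f z = g z := by
  obtain ⟨w, rfl⟩ := CocommRightHopfAlgebroid.bijective_canonicalMap.2 z
  exact addHom_congr (f.comp (canonicalMap A U)) (g.comp (canonicalMap A U)) h w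

end Canonical

namespace ProfMod

section Dual

variable {A : Type u} {U : Type v} [CommRing A] [Ring U] [Module A U] [Coalgebra A U]
variable [CocommRightHopfAlgebroid A U]

/-- The additive map `F` on `U ⊗[A] U` with `F(x u₁ ⊗ u₂) = φ(p x) · u`, where `·` is the action on
the unit object `A`.  It exists because the canonical map is bijective, and its value at `x ⊗ u` is
the value at `p x` of `φ u`, for the action of `U` on the dual module. -/
def pairing (P : ProfMod A U) (φ : Module.Dual A P) (p : P) : U ⊗[A] U →+ A :=
  (TensorProduct.liftAddHom (R := A) (M := U) (N := LeftMod A U)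
    (AddMonoidHom.mk' (fun x : U => AddMonoidHom.mk'
        (fun u : LeftMod A U => Coalgebra.counit (R := A)
          (ARing.s (φ (MulOpposite.op x • p)) * (show U from u)))
        (fun u v => by
          change Coalgebra.counit (R := A) (ARing.s (φ (MulOpposite.op x • p)) *
            ((show U from u) + (show U from v))) = _
          rw [mul_add, map_add]))
      (fun x y => by
        refine AddMonoidHom.ext fun (u : U) => ?_
        change Coalgebra.counit (R := A) (ARing.s (φ (MulOpposite.op (x + y) • p)) * u) =
          Coalgebra.counit (R := A) (ARing.s (φ (MulOpposite.op x • p)) * u) +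
            Coalgebra.counit (R := A) (ARing.s (φ (MulOpposite.op y • p)) * u)
        rw [MulOpposite.op_add, add_smul, map_add, map_add, add_mul, map_add]))
    (fun a x (u : U) => by
      change Coalgebra.counit (R := A) (ARing.s (φ (MulOpposite.op (a • x) • p)) * u) =
        Coalgebra.counit (R := A) (ARing.s (φ (MulOpposite.op x • p)) * (ARing.s a * u))
      rw [ARing.smul_eq, MulOpposite.op_mul, mul_smul, op_s_smul, map_smul, smul_eq_mul,
        mul_comm, map_mul ARing.s, mul_assoc])).comp
    (AddEquiv.ofBijective (canonicalMap A U)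
      CocommRightHopfAlgebroid.bijective_canonicalMap).symm.toAddMonoidHom

theorem pairing_canonical (P : ProfMod A U) (φ : Module.Dual A P) (p : P) (x u : U) :
    pairing P φ p (lmul₂ A x 1 (Coalgebra.comul u)) =
      Coalgebra.counit (R := A) (ARing.s (φ (MulOpposite.op x • p)) * u) := by
  have h : (AddEquiv.ofBijective (canonicalMap A U)
      CocommRightHopfAlgebroid.bijective_canonicalMap).symm (lmul₂ A x 1 (Coalgebra.comul u)) =
      x ⊗ₜ[A] (show LeftMod A U from u) := (AddEquiv.symm_apply_eq _).2 rfl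
  exact congrArg _ h

theorem pairing_add_left (P : ProfMod A U) (φ ψ : Module.Dual A P) (p : P) (z : U ⊗[A] U) :
    pairing P (φ + ψ) p z = pairing P φ p z + pairing P ψ p z :=
  addHom_ext_canonical (pairing P (φ + ψ) p) (pairing P φ p + pairing P ψ p) (fun x u => by
    simp only [AddMonoidHom.add_apply, pairing_canonical, LinearMap.add_apply, map_add, add_mul]) z

theorem pairing_add_right (P : ProfMod A U) (φ : Module.Dual A P) (p q : P) (z : U ⊗[A] U) :
    pairing P φ (p + q) z = pairing P φ p z + pairing P φ q z :=
  addHom_ext_canonical (pairing P φ (p + q)) (pairing P φ p + pairing P φ q) (fun x u => by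
    simp only [AddMonoidHom.add_apply, pairing_canonical, smul_add, map_add, add_mul]) z

theorem pairing_smul (P : ProfMod A U) (φ : Module.Dual A P) (p : P) (a : A) (z : U ⊗[A] U) :
    pairing P φ p (a • z) = a * pairing P φ p z :=
  addHom_ext_canonical ((pairing P φ p).comp (DistribSMul.toAddMonoidHom _ a))
    ((AddMonoidHom.mulLeft a).comp (pairing P φ p)) (fun x u => by
      change pairing P φ p (a • lmul₂ A x 1 (Coalgebra.comul u)) =
        a * pairing P φ p (lmul₂ A x 1 (Coalgebra.comul u))
      rw [← map_smul, ← map_smul, pairing_canonical, pairing_canonical, ARing.smul_eq, ← mul_assoc,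
        ← ARing.smul_eq, map_smul, smul_eq_mul]) z

theorem pairing_op_smul (P : ProfMod A U) (φ : Module.Dual A P) (p : P) (y : U) (z : U ⊗[A] U) :
    pairing P φ (MulOpposite.op y • p) z = pairing P φ p (lmul₂ A y 1 z) :=
  addHom_ext_canonical (pairing P φ (MulOpposite.op y • p))
    ((pairing P φ p).comp (lmul₂ A y 1).toAddMonoidHom) (fun x u => by
      change _ = pairing P φ p (lmul₂ A y 1 (lmul₂ A x 1 (Coalgebra.comul u)))
      rw [lmul₂_lmul₂, mul_one, pairing_canonical, pairing_canonical, MulOpposite.op_mul,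
        mul_smul]) z

/-- The action `φ ↦ φ u` on the dual module. -/
def dualAct (P : ProfMod A U) (u : U) (φ : Module.Dual A P) : Module.Dual A P where
  toFun p := pairing P φ p (1 ⊗ₜ u)
  map_add' p q := pairing_add_right P φ p q _
  map_smul' a p := by
    have h : lmul₂ A (ARing.s a) 1 ((1 : U) ⊗ₜ[A] u) = a • ((1 : U) ⊗ₜ[A] u) := by
      simp [lmul₂, TensorProduct.smul_tmul', ARing.smul_eq]
    rw [← op_s_smul, pairing_op_smul, h, pairing_smul]
    rfl

theorem pairing_tmul (P : ProfMod A U) (φ : Module.Dual A P) (p : P) (x u : U) :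
    pairing P φ p (x ⊗ₜ u) = dualAct P u φ (MulOpposite.op x • p) := by
  change _ = pairing P φ (MulOpposite.op x • p) (1 ⊗ₜ u)
  rw [pairing_op_smul]
  simp [lmul₂]

/-- `(φ u)(p) · v = ∑ φ(u v₂)(p v₁)`. -/
theorem counit_dualAct (P : ProfMod A U) (φ : Module.Dual A P) (p : P) (u v : U) :
    Coalgebra.counit (R := A) (ARing.s (dualAct P u φ p) * v) =
      pairing P φ p (lmul₂ A 1 u (Coalgebra.comul v)) := by
  let g : A →+ A := AddMonoidHom.mk' (fun a => Coalgebra.counit (R := A) (ARing.s a * v))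
    (fun a b => by rw [map_add, add_mul, map_add])
  refine addHom_ext_canonical (g.comp (pairing P φ p)) ((pairing P φ p).comp (mulComul v))
    (fun x w => ?_) (1 ⊗ₜ u)
  change Coalgebra.counit (R := A)
      (ARing.s (pairing P φ p (lmul₂ A x 1 (Coalgebra.comul w))) * v) =
    pairing P φ p (mulComul v (lmul₂ A x 1 (Coalgebra.comul w)))
  rw [mulComul_lmul₂, mulComul_comul, pairing_canonical, pairing_canonical, ← mul_assoc,
    ← CocommRightBialgebroid.counit_mul]

/-- `F(x ⊗ u v) = F'(x ⊗ v)` for the maps `F`, `F'` belonging to `φ` and `φ u`: the associativity of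
the action on the dual module. -/
theorem pairing_dualAct (P : ProfMod A U) (φ : Module.Dual A P) (p : P) (u : U) (z : U ⊗[A] U) :
    pairing P (dualAct P u φ) p z = pairing P φ p (lmul₂ A 1 u z) :=
  addHom_ext_canonical (pairing P (dualAct P u φ) p)
    ((pairing P φ p).comp (lmul₂ A 1 u).toAddMonoidHom) (fun x v => by
      change _ = pairing P φ p (lmul₂ A 1 u (lmul₂ A x 1 (Coalgebra.comul v)))
      have h := pairing_op_smul P φ p x (lmul₂ A 1 u (Coalgebra.comul v))
      rw [lmul₂_lmul₂, mul_one, one_mul] at h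
      rw [pairing_canonical, counit_dualAct, h, lmul₂_lmul₂, mul_one, one_mul]) z

theorem dualAct_mul (P : ProfMod A U) (φ : Module.Dual A P) (u v : U) :
    dualAct P (u * v) φ = dualAct P v (dualAct P u φ) := by
  ext p
  refine Eq.trans ?_ (pairing_dualAct P φ p u (1 ⊗ₜ v)).symm
  simp only [lmul₂, TensorProduct.map_tmul, lmul_apply, mul_one]
  rfl

theorem dualAct_one (P : ProfMod A U) (φ : Module.Dual A P) : dualAct P 1 φ = φ := by
  ext p
  have h := pairing_canonical P φ p 1 1
  rw [CocommRightBialgebroid.comul_one, lmul₂_one_one, MulOpposite.op_one, one_smul, mul_one,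
    counit_s] at h
  exact h

/-- The dual `P*` of a profinite right `U`-module, with `(φ u)(p) = F(1 ⊗ u)` for the map `F` of
`pairing`. -/
def dual (P : ProfMod A U) : ProfMod A U :=
  letI : Module Uᵐᵒᵖ (Module.Dual A P) :=
    { smul := fun u φ => dualAct P u.unop φ
      one_smul := dualAct_one P
      mul_smul := fun u v φ => dualAct_mul P φ v.unop u.unop
      smul_zero := fun u => by
        ext p
        have h := pairing_add_left P 0 0 p (1 ⊗ₜ u.unop)
        rw [add_zero, left_eq_add] at h
        exact h
      smul_add := fun u φ ψ => by ext p; exact pairing_add_left P φ ψ p _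
      add_smul := fun u v φ => by
        ext p
        change pairing P φ p (1 ⊗ₜ (u.unop + v.unop)) = _
        rw [TensorProduct.tmul_add, map_add]
        rfl
      zero_smul := fun φ => by
        ext p
        change pairing P φ p (1 ⊗ₜ 0) = _
        rw [TensorProduct.tmul_zero, map_zero]
        rfl }
  { carrier := Module.Dual A P
    op_s_smul := fun a φ => by
      ext p
      change pairing P φ p (1 ⊗ₜ ARing.s a) = a • φ p
      rw [s_eq, TensorProduct.tmul_smul, pairing_smul, pairing_tmul, dualAct_one]
      simp }

/-- The linear map `p ⊗ φ ↦ φ(p)`. -/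
def evLin (A P : Type*) [CommRing A] [AddCommGroup P] [Module A P] :
    P ⊗[A] Module.Dual A P →ₗ[A] A := TensorProduct.lift (Module.Dual.eval A P)

/-- The orbit map `u ↦ φ u` of a linear form. -/
def dualOrbit (P : ProfMod A U) (φ : Module.Dual A P) : U →ₗ[A] Module.Dual A P := (dual P).orbit φ

/-- `∑ (φ u)(p x) = F(∑ x ⊗ u)` for the map `F` of `pairing`. -/
theorem evLin_map_orbit (P : ProfMod A U) (φ : Module.Dual A P) (p : P) (z : U ⊗[A] U) :
    evLin A P (TensorProduct.map (P.orbit p) (dualOrbit P φ) z) = pairing P φ p z := by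
  induction z with
  | zero => simp
  | add z z' h h' => simp only [map_add, h, h']
  | tmul x u => rw [pairing_tmul]; rfl

/-- The evaluation `P ⊗ P* → A` is a morphism of right `U`-modules. -/
def ev (P : ProfMod A U) : P ⊗ dual P ⟶ 𝟙_ (ProfMod A U) where
  hom := evLin A P
  map_op_smul u z := by
    let g : A →+ A := AddMonoidHom.mk' (fun a => Coalgebra.counit (R := A) (ARing.s a * u))
      (fun a b => by rw [map_add, add_mul, map_add])
    let act : P ⊗[A] Module.Dual A P →+ P ⊗[A] Module.Dual A P := tensorAct P (dual P) u
    refine addHom_congr ((evLin A P).toAddMonoidHom.comp act)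
      (g.comp (evLin A P).toAddMonoidHom) (fun p φ => ?_) z
    refine (evLin_map_orbit P φ p (Coalgebra.comul u)).trans ?_
    have h := pairing_canonical P φ p 1 u
    rw [lmul₂_one_one, MulOpposite.op_one, one_smul] at h
    exact h

/-- A morphism `f : P ⊗ M → A` induces a morphism `M → P*`, `m ↦ f(- ⊗ m)`. -/
def homDual {P M : ProfMod A U} (f : P ⊗ M ⟶ 𝟙_ (ProfMod A U)) : M ⟶ dual P where
  hom := (TensorProduct.curry (show P ⊗[A] M →ₗ[A] A from Hom.lin f)).flip
  map_op_smul u m := by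
    refine LinearMap.ext fun (p : P) => ?_
    let f' : P ⊗[A] M →ₗ[A] A := Hom.lin f
    let φ : Module.Dual A P := (TensorProduct.curry f').flip m
    have key := addHom_ext_canonical (A := A)
      (f'.toAddMonoidHom.comp (TensorProduct.map (P.orbit p) (M.orbit m)).toAddMonoidHom)
      (pairing P φ p) (fun x u => by
        rw [pairing_canonical]
        have h : f' (orbit₂ P M (MulOpposite.op x • p) m u) =
          Coalgebra.counit (R := A) (ARing.s (φ (MulOpposite.op x • p)) * u) :=
          lin_op_smul f u ((MulOpposite.op x • p) ⊗ₜ[A] m)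
        refine Eq.trans ?_ h
        refine congrArg f' ?_
        change TensorProduct.map (P.orbit p) (M.orbit m) (lmul₂ A x 1 (Coalgebra.comul u)) =
          TensorProduct.map (P.orbit (MulOpposite.op x • p)) (M.orbit m) (Coalgebra.comul u)
        generalize Coalgebra.comul (R := A) u = z
        induction z with
        | zero => simp
        | add z z' h h' => simp only [map_add, h, h']
        | tmul y z => simp [lmul₂, mul_smul]) (1 ⊗ₜ u)
    refine Eq.trans ?_ key
    change f' (p ⊗ₜ (MulOpposite.op u • m)) =
      f' (TensorProduct.map (P.orbit p) (M.orbit m) (1 ⊗ₜ u))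
    simp

end Dual

end ProfMod

/-! ### The bialgebroid structure of the finite dual -/

namespace FinDual

variable {A : Type u} {U : Type v} [CommRing A] [Ring U] [Module A U] [Coalgebra A U]

section Bialgebroid

variable [CocommRightBialgebroid A U]

variable (A U) in
/-- The counit `φ ⊗ p ↦ φ(p)` as an additive map. -/
def counitAdd : FinDual A U →+ A :=
  lift (fun _ => AddMonoidHom.mk' (fun φ => φ.toAddMonoidHom) (fun _ _ => rfl))
    (fun _ _ _ _ _ => rfl)

theorem counitAdd_mk (P : ProfMod A U) (φ : Module.Dual A P) (p : P) :
    counitAdd A U (mk P φ p) = φ p := lift_mk _ _ P φ p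

variable (A U) in
/-- The counit `φ ⊗ p ↦ φ(p)` of the finite dual. -/
def counit : FinDual A U →+* A :=
  { counitAdd A U with
    map_one' := (counitAdd_mk _ _ _).trans (mul_one (1 : A))
    map_mul' := fun x y => by
      change counitAdd A U (x * y) = counitAdd A U x * counitAdd A U y
      induction x using induction_on with
      | zero => simp
      | add x x' hx hx' => simp only [add_mul, map_add, hx, hx']
      | mk P φ p =>
        induction y using induction_on with
        | zero => simp
        | add y y' hy hy' => simp only [mul_add, map_add, hy, hy']
        | mk Q ψ q =>
          rw [mk_mul_mk, counitAdd_mk, counitAdd_mk, counitAdd_mk, star_tmul, mul_comm] }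

theorem counit_mk (P : ProfMod A U) (φ : Module.Dual A P) (p : P) :
    counit A U (mk P φ p) = φ p := counitAdd_mk P φ p

variable (K : Type*) [CommRing K] [Algebra K A] [Algebra K U] [IsScalarTower K A U]

variable (A U) in
/-- The source of the finite dual as a homomorphism of algebras over `T_A`. -/
def srcAlg : A →ₐ[unitEnd K A U] FinDual A U :=
  { src A U with commutes' := fun _ => rfl }

/-- Multiplication by an element of `T_A`, as an endomorphism of the unit object. -/
def unitEndHom (a : unitEnd K A U) : 𝟙_ (ProfMod A U) ⟶ 𝟙_ (ProfMod A U) where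
  hom := LinearMap.mulLeft A (a : A)
  map_op_smul u (b : A) := by
    change (a : A) * Coalgebra.counit (R := A) (ARing.s b * u) =
      Coalgebra.counit (R := A) (ARing.s ((a : A) * b) * u)
    rw [a.2, map_mul ARing.s, mul_assoc]

variable (A U) in
/-- The target of the finite dual as a homomorphism of algebras over `T_A`. -/
def tgtAlg : A →ₐ[unitEnd K A U] FinDual A U :=
  { tgt A U with
    commutes' := fun a => by
      -- the classes of `l_a ⊗ 1` and `id ⊗ a` agree because `l_a` is an endomorphism of `A`
      refine (mk_eq_mk (unitEndHom K a) (mul_one (a : A)) ?_).symm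
      exact LinearMap.ext fun b : A => one_mul ((a : A) * b) }

variable (A U) in
/-- The finite dual as an `A`-algebra through the target. -/
abbrev TgtAlg := Via (tgtAlg A U K : A →+* FinDual A U)

variable (A U) in
/-- The finite dual as an `A`-algebra through the source. -/
abbrev SrcAlg := Via (srcAlg A U K : A →+* FinDual A U)

theorem smul_toVia_src (a : A) (P : ProfMod A U) (φ : Module.Dual A P) (p : P) :
    a • (toVia (srcAlg A U K : A →+* FinDual A U) (mk P φ p)) = toVia _ (mk P (a • φ) p) :=
  src_mul_mk a P φ p

theorem smul_toVia_tgt (a : A) (P : ProfMod A U) (φ : Module.Dual A P) (p : P) :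
    a • (toVia (tgtAlg A U K : A →+* FinDual A U) (mk P φ p)) = toVia _ (mk P φ (a • p)) :=
  tgt_mul_mk a P φ p

/-- The biadditive map `(φ, p) ↦ ∑ (φ ⊗ eᵢ) ⊗ (eᵢ* ⊗ p)`. -/
def comulMk (P : ProfMod A U) {ι : Type*} [Fintype ι] (e : ι → P) (e' : ι → Module.Dual A P) :
    Module.Dual A P →+ P →+ TgtAlg A U K ⊗[A] SrcAlg A U K :=
  AddMonoidHom.mk' (fun φ => AddMonoidHom.mk' (fun p =>
      ∑ i, toVia (tgtAlg A U K : A →+* FinDual A U) (mk P φ (e i)) ⊗ₜ[A]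
        toVia (srcAlg A U K : A →+* FinDual A U) (mk P (e' i) p))
      (fun p q => by
        simp only [mk_add_right, map_add, TensorProduct.tmul_add, Finset.sum_add_distrib]))
    (fun φ ψ => by
      ext p
      simp only [AddMonoidHom.mk'_apply, AddMonoidHom.add_apply, mk_add_left, map_add,
        TensorProduct.add_tmul, Finset.sum_add_distrib])

theorem comulMk_apply (P : ProfMod A U) {ι : Type*} [Fintype ι] (e : ι → P)
    (e' : ι → Module.Dual A P) (φ : Module.Dual A P) (p : P) :
    comulMk K P e e' φ p = ∑ i, toVia (tgtAlg A U K : A →+* FinDual A U) (mk P φ (e i)) ⊗ₜ[A]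
      toVia (srcAlg A U K : A →+* FinDual A U) (mk P (e' i) p) := rfl

/-- The comultiplication respects the relation `φ ⊗ t p = φ t ⊗ p`; for `t = 𝟙 P`, it does not depend
on the dual basis. -/
theorem comulMk_lin {P Q : ProfMod A U} (t : P ⟶ Q) {ι κ : Type*} [Fintype ι] [Fintype κ]
    (e : ι → P) (e' : ι → Module.Dual A P) (he : ∀ x, ∑ i, e' i x • e i = x)
    (d : κ → Q) (d' : κ → Module.Dual A Q) (hd : ∀ x, ∑ i, d' i x • d i = x)
    (φ : Module.Dual A Q) (p : P) :
    comulMk K Q d d' φ (ProfMod.Hom.lin t p) = comulMk K P e e' (φ ∘ₗ ProfMod.Hom.lin t) p := by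
  have h₁ : ∀ i, toVia (tgtAlg A U K : A →+* FinDual A U)
        (mk P (φ ∘ₗ ProfMod.Hom.lin t) (e i)) ⊗ₜ[A]
        toVia (srcAlg A U K : A →+* FinDual A U) (mk P (e' i) p) =
      ∑ j, toVia (tgtAlg A U K : A →+* FinDual A U) (mk Q φ (d j)) ⊗ₜ[A]
        toVia (srcAlg A U K : A →+* FinDual A U)
          (mk P (d' j (ProfMod.Hom.lin t (e i)) • e' i) p) := fun i => by
    conv_lhs => rw [← mk_lin, ← hd (ProfMod.Hom.lin t (e i))]
    have h : mk Q φ (∑ j, d' j (ProfMod.Hom.lin t (e i)) • d j) =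
        ∑ j, mk Q φ (d' j (ProfMod.Hom.lin t (e i)) • d j) := map_sum (mkHom Q φ) _ _
    rw [h, map_sum, TensorProduct.sum_tmul]
    refine Finset.sum_congr rfl fun j _ => ?_
    rw [← smul_toVia_tgt, TensorProduct.smul_tmul, smul_toVia_src]
  rw [comulMk_apply, comulMk_apply, Finset.sum_congr rfl fun i _ => h₁ i, Finset.sum_comm]
  refine Finset.sum_congr rfl fun j _ => ?_
  rw [← TensorProduct.tmul_sum, ← map_sum, ← mk_sum_left, mk_lin]
  congr 3
  ext x
  conv_lhs => rw [LinearMap.comp_apply, ← he x, map_sum, map_sum]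
  simp [mul_comm]

variable (A U) in
/-- The comultiplication of the finite dual as an additive map. -/
def comulAdd : FinDual A U →+ TgtAlg A U K ⊗[A] SrcAlg A U K :=
  lift (fun P => comulMk K P (exists_dualBasis A P).choose_spec.choose
      (exists_dualBasis A P).choose_spec.choose_spec.choose)
    (fun P Q t φ p => comulMk_lin K t _ _
      (exists_dualBasis A P).choose_spec.choose_spec.choose_spec _ _
      (exists_dualBasis A Q).choose_spec.choose_spec.choose_spec φ p)

theorem comulAdd_mk (P : ProfMod A U) {ι : Type*} [Fintype ι] (e : ι → P)
    (e' : ι → Module.Dual A P) (he : ∀ x, ∑ i, e' i x • e i = x) (φ : Module.Dual A P) (p : P) :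
    comulAdd A U K (mk P φ p) = comulMk K P e e' φ p :=
  (lift_mk _ _ P φ p).trans (comulMk_lin K (𝟙 P) e e' he _ _
    (exists_dualBasis A P).choose_spec.choose_spec.choose_spec φ p)

theorem comulAdd_unitMk (a b : A) : comulAdd A U K (unitMk a b) =
    toVia (tgtAlg A U K : A →+* FinDual A U) (unitMk a 1) ⊗ₜ[A]
      toVia (srcAlg A U K : A →+* FinDual A U) (unitMk 1 b) := by
  refine (comulAdd_mk K (𝟙_ (ProfMod A U)) (ι := Unit) (fun _ => (1 : A))
    (fun _ => (LinearMap.mulLeft A 1 : Module.Dual A A)) (fun x : A => ?_) _ _).trans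
    ((comulMk_apply K _ _ _ _ _).trans (Fintype.sum_unique _))
  rw [Fintype.sum_unique]
  change (1 * x) * 1 = x
  rw [mul_one, one_mul]

theorem tensor_dualBasis {P Q : ProfMod A U} {ι κ : Type*} [Fintype ι] [Fintype κ]
    {e : ι → P} {e' : ι → Module.Dual A P} (he : ∀ x, ∑ i, e' i x • e i = x)
    {d : κ → Q} {d' : κ → Module.Dual A Q} (hd : ∀ x, ∑ i, d' i x • d i = x)
    (z : (P ⊗ Q : ProfMod A U)) :
    ∑ k : ι × κ, star (e' k.1) (d' k.2) z • tmul (e k.1) (d k.2) = z := by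
  have key : ∀ w : P ⊗[A] Q, ∑ k : ι × κ,
      (LinearMap.mul' A A ∘ₗ TensorProduct.map (e' k.1) (d' k.2)) w • (e k.1 ⊗ₜ[A] d k.2) = w := by
    intro w
    induction w with
    | zero => simp
    | add w w' h h' => simp only [map_add, add_smul, Finset.sum_add_distrib, h, h']
    | tmul p q =>
      conv_rhs => rw [← he p, ← hd q, TensorProduct.sum_tmul]
      rw [Fintype.sum_prod_type]
      refine Finset.sum_congr rfl fun i _ => ?_
      rw [TensorProduct.tmul_sum]
      refine Finset.sum_congr rfl fun j _ => ?_
      rw [TensorProduct.smul_tmul_smul]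
      rfl
  exact key z

variable (A U) in
/-- The comultiplication `φ ⊗ p ↦ ∑ (φ ⊗ eᵢ) ⊗ (eᵢ* ⊗ p)` of the finite dual. -/
def comul : FinDual A U →+* TgtAlg A U K ⊗[A] SrcAlg A U K :=
  { comulAdd A U K with
    map_one' := comulAdd_unitMk K 1 1
    map_mul' := fun x y => by
      change comulAdd A U K (x * y) = comulAdd A U K x * comulAdd A U K y
      induction x using induction_on with
      | zero => simp
      | add x x' hx hx' => simp only [add_mul, map_add, hx, hx']
      | mk P φ p =>
        induction y using induction_on with
        | zero => simp
        | add y y' hy hy' => simp only [mul_add, map_add, hy, hy']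
        | mk Q ψ q =>
          obtain ⟨n, e, e', he⟩ := exists_dualBasis A P
          obtain ⟨m, d, d', hd⟩ := exists_dualBasis A Q
          rw [mk_mul_mk, comulAdd_mk K (Q ⊗ P) (fun k : Fin m × Fin n => tmul (d k.1) (e k.2))
            (fun k => star (d' k.1) (e' k.2)) (tensor_dualBasis hd he), comulAdd_mk K P e e' he,
            comulAdd_mk K Q d d' hd, comulMk_apply, comulMk_apply, comulMk_apply,
            Finset.sum_mul_sum, Finset.sum_comm, Fintype.sum_prod_type]
          refine Finset.sum_congr rfl fun j _ => Finset.sum_congr rfl fun i _ => ?_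
          rw [← mk_mul_mk, ← mk_mul_mk, map_mul, map_mul, Algebra.TensorProduct.tmul_mul_tmul] }

variable (A U) in
/-- The finite dual as a commutative bialgebroid over `T_A`. -/
def bialgebroid : CommBialgebroidData (unitEnd K A U) A (FinDual A U) where
  s := srcAlg A U K
  t := tgtAlg A U K
  comul := comul A U K
  counit := counit A U
  comul_s a := comulAdd_unitMk K a 1
  comul_t a := comulAdd_unitMk K 1 a
  counit_s a := (counit_mk _ _ _).trans (mul_one a)
  counit_t a := (counit_mk _ _ _).trans (one_mul a)

theorem isFinDual_bialgebroid : IsFinDual (bialgebroid A U K) where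
  source _ := rfl
  target _ := rfl
  counit := counit_mk
  comul P φ p _ e e' he := comulAdd_mk K P e e' he φ p

variable {K} {C : CommBialgebroidData (unitEnd K A U) A (FinDual A U)}

theorem coassoc_of_isFinDual (hC : IsFinDual C) (h : FinDual A U) :
    C.comulLin.lTensor C.Tgt (C.comul h) =
      C.coactTensor C.comulCoact C.comulCoact_smul (C.comul h) := by
  induction h using induction_on with
  | zero => simp
  | add x y hx hy => simp only [map_add, hx, hy]
  | mk P φ p =>
    obtain ⟨n, e, e', he⟩ := exists_dualBasis A P
    have h := fun (φ : Module.Dual A P) p => hC.comul P φ p n e e' he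
    rw [h, map_sum, map_sum]
    have h₁ : ∀ i, C.comulLin.lTensor C.Tgt
        (C.toTgt (mk P φ (e i)) ⊗ₜ[A] C.toSrc (mk P (e' i) p)) =
        ∑ j, C.toTgt (mk P φ (e i)) ⊗ₜ[A]
          C.append (mk P (e' j) p) (C.toSrc (mk P (e' i) (e j))) := fun i => by
      rw [LinearMap.lTensor_tmul, ← TensorProduct.tmul_sum]
      exact congrArg (fun z : C.SrcSq => C.toTgt (mk P φ (e i)) ⊗ₜ[A] z) (h (e' i) p)
    have h₂ : ∀ j, C.coactTensor C.comulCoact C.comulCoact_smul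
        (C.toTgt (mk P φ (e j)) ⊗ₜ[A] C.toSrc (mk P (e' j) p)) =
        ∑ i, C.toTgt (mk P φ (e i)) ⊗ₜ[A]
          C.append (mk P (e' j) p) (C.toSrc (mk P (e' i) (e j))) := fun j => by
      change (C.append (mk P (e' j) p)).lTensor C.Tgt (C.comul (mk P φ (e j))) = _
      rw [h, map_sum]
      simp only [LinearMap.lTensor_tmul]
    rw [Finset.sum_congr rfl fun i _ => h₁ i, Finset.sum_congr rfl fun i _ => h₂ i,
      Finset.sum_comm]

theorem pair_comul (hC : IsFinDual C) {B : Type*} [CommRing B] (f g : FinDual A U →+* B)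
    (hfg : ∀ a, f (C.t a) = g (C.s a)) (P : ProfMod A U) {n : ℕ} (e : Fin n → P)
    (e' : Fin n → Module.Dual A P) (he : IsDualBasis e e') (φ : Module.Dual A P) (p : P) :
    C.pair f g hfg (C.comul (mk P φ p)) = ∑ i, f (mk P φ (e i)) * g (mk P (e' i) p) := by
  rw [hC.comul P φ p n e e' he, map_sum]
  rfl

theorem counit_left_of_isFinDual (hC : IsFinDual C) (h : FinDual A U) :
    C.pair ((C.s : A →+* FinDual A U).comp C.counit) (RingHom.id (FinDual A U))
      (fun a => congrArg C.s (C.counit_t a)) (C.comul h) = h := by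
  induction h using induction_on with
  | zero => simp
  | add x y hx hy => simp only [map_add, hx, hy]
  | mk P φ p =>
    obtain ⟨n, e, e', he⟩ := exists_dualBasis A P
    refine (pair_comul hC _ _ _ P e e' he φ p).trans ?_
    have h₁ : ∀ i, C.s (C.counit (mk P φ (e i))) * mk P (e' i) p = mk P (φ (e i) • e' i) p :=
      fun i => by rw [hC.counit, hC.source, src_mul_mk]
    refine (Finset.sum_congr rfl fun i _ => h₁ i).trans ?_
    rw [← mk_sum_left]
    congr 1
    ext x
    conv_rhs => rw [← he x, map_sum]
    simp [mul_comm]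

theorem counit_right_of_isFinDual (hC : IsFinDual C) (h : FinDual A U) :
    C.pair (RingHom.id (FinDual A U)) ((C.t : A →+* FinDual A U).comp C.counit)
      (fun a => (congrArg C.t (C.counit_s a)).symm) (C.comul h) = h := by
  induction h using induction_on with
  | zero => simp
  | add x y hx hy => simp only [map_add, hx, hy]
  | mk P φ p =>
    obtain ⟨n, e, e', he⟩ := exists_dualBasis A P
    refine (pair_comul hC _ _ _ P e e' he φ p).trans ?_
    have h₁ : ∀ i, mk P φ (e i) * C.t (C.counit (mk P (e' i) p)) = mk P φ (e' i p • e i) :=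
      fun i => by rw [hC.counit, hC.target, mul_comm, tgt_mul_mk]
    refine (Finset.sum_congr rfl fun i _ => h₁ i).trans ?_
    conv_rhs => rw [← he p]
    exact (map_sum (mkHom P φ) _ _).symm

end Bialgebroid

/-! ### The antipode -/

section Antipode

open ProfMod

variable [CocommRightHopfAlgebroid A U]

/-- The evaluation of linear forms at `p`. -/
def evalAt (P : ProfMod A U) (p : P) : Module.Dual A (dual P) := Module.Dual.eval A P p

/-- A linear form as an element of the dual module. -/
def toDual (P : ProfMod A U) (φ : Module.Dual A P) : dual P := φ

/-- The class of `evₚ ⊗ φ` for the dual module. -/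
def dualMk (P : ProfMod A U) (φ : Module.Dual A P) (p : P) : FinDual A U :=
  mk (dual P) (evalAt P p) (toDual P φ)

/-- A pairing `f : P ⊗ M → A` in the category of modules identifies `evₚ ⊗ f(- ⊗ m)` with
`f(p ⊗ -) ⊗ m`. -/
theorem dualMk_eq_mk {P M : ProfMod A U} (f : P ⊗ M ⟶ 𝟙_ (ProfMod A U)) {φ : Module.Dual A P}
    {p : P} {ψ : Module.Dual A M} {m : M} (hφ : ∀ x : P, φ x = (Hom.lin f (tmul x m) : A))
    (hψ : ∀ y : M, ψ y = (Hom.lin f (tmul p y) : A)) : dualMk P φ p = mk M ψ m :=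
  (mk_eq_mk (homDual f) (LinearMap.ext fun x => (hφ x).symm)
    (LinearMap.ext fun y => (hψ y).symm)).symm

theorem dualMk_lin {P Q : ProfMod A U} (t : P ⟶ Q) (φ : Module.Dual A Q) (p : P) :
    dualMk Q φ (Hom.lin t p) = dualMk P (φ ∘ₗ Hom.lin t) p :=
  (dualMk_eq_mk (t ▷ dual Q ≫ ev Q) (fun _ => rfl) (fun _ => rfl)).symm

variable (A U) in
/-- The antipode `φ ⊗ p ↦ evₚ ⊗ φ` as an additive map. -/
def antipodeAdd : FinDual A U →+ FinDual A U :=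
  lift (fun P => AddMonoidHom.mk' (fun φ => AddMonoidHom.mk' (dualMk P φ)
        (fun p q => by
          have h : evalAt P (p + q) = evalAt P p + evalAt P q := map_add (Module.Dual.eval A P) p q
          rw [dualMk, h, mk_add_left]
          rfl))
      (fun φ ψ => by ext p; exact mk_add_right (dual P) (evalAt P p) _ _))
    (fun _ _ t φ p => dualMk_lin t φ p)

theorem antipodeAdd_mk (P : ProfMod A U) (φ : Module.Dual A P) (p : P) :
    antipodeAdd A U (mk P φ p) = dualMk P φ p := lift_mk _ _ P φ p

theorem antipodeAdd_unitMk (a b : A) : antipodeAdd A U (unitMk a b) = unitMk b a := by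
  refine (antipodeAdd_mk _ _ _).trans (dualMk_eq_mk (λ_ (𝟙_ (ProfMod A U))).hom
    (fun x => mul_comm a (show A from x)) (fun _ => rfl))

/-- The canonical pairing `(Q ⊗ P) ⊗ (Q* ⊗ P*) → A`. -/
def tensorPairing (Q P : ProfMod A U) : (Q ⊗ P) ⊗ (dual Q ⊗ dual P) ⟶ 𝟙_ (ProfMod A U) :=
  tensorμ Q P (dual Q) (dual P) ≫ (ev Q ⊗ₘ ev P) ≫ (λ_ (𝟙_ (ProfMod A U))).hom

variable (A U) in
/-- The antipode `φ ⊗ p ↦ evₚ ⊗ φ` of the finite dual. -/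
def antipode : FinDual A U →+* FinDual A U :=
  { antipodeAdd A U with
    map_one' := antipodeAdd_unitMk 1 1
    map_mul' := fun x y => by
      change antipodeAdd A U (x * y) = antipodeAdd A U x * antipodeAdd A U y
      induction x using induction_on with
      | zero => simp
      | add x x' hx hx' => simp only [add_mul, map_add, hx, hx']
      | mk P φ p =>
        induction y using induction_on with
        | zero => simp
        | add y y' hy hy' => simp only [mul_add, map_add, hy, hy']
        | mk Q ψ q =>
          rw [mk_mul_mk, antipodeAdd_mk, antipodeAdd_mk, antipodeAdd_mk]
          refine Eq.trans ?_ (mk_mul_mk (dual P) (dual Q) (evalAt P p) (toDual P φ) (evalAt Q q)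
            (toDual Q ψ)).symm
          refine dualMk_eq_mk (tensorPairing Q P) (fun x => ?_) (fun y => ?_)
          · exact LinearMap.congr_fun (f := star ψ φ) (TensorProduct.ext' fun _ _ => rfl :
              star ψ φ = (Hom.lin (tensorPairing Q P)) ∘ₗ
                (TensorProduct.mk A (Q ⊗[A] P) (Module.Dual A Q ⊗[A] Module.Dual A P)).flip
                  (ψ ⊗ₜ φ)) x
          · exact LinearMap.congr_fun (TensorProduct.ext' fun _ _ => rfl :
              star (evalAt Q q) (evalAt P p) = (Hom.lin (tensorPairing Q P)) ∘ₗ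
                (TensorProduct.mk A (Q ⊗[A] P) (Module.Dual A Q ⊗[A] Module.Dual A P))
                  (q ⊗ₜ p)) y }

theorem antipode_mk (P : ProfMod A U) (φ : Module.Dual A P) (p : P) :
    antipode A U (mk P φ p) = dualMk P φ p := antipodeAdd_mk P φ p

theorem antipode_src (a : A) : antipode A U (src A U a) = tgt A U a := antipodeAdd_unitMk a 1

theorem antipode_tgt (a : A) : antipode A U (tgt A U a) = src A U a := antipodeAdd_unitMk 1 a

/-- `P` is isomorphic to its double dual, so the antipode is an involution. -/
theorem antipode_antipode (x : FinDual A U) : antipode A U (antipode A U x) = x := by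
  induction x using induction_on with
  | zero => simp
  | add x y hx hy => simp only [map_add, hx, hy]
  | mk P φ p =>
    rw [antipode_mk, dualMk, antipode_mk]
    exact dualMk_eq_mk ((β_ (dual P) P).hom ≫ ev P) (fun _ => rfl) (fun _ => rfl)

/-- `∑ S(φ ⊗ eᵢ) (eᵢ* ⊗ p) = t(φ(p))`: the left-hand side is the class of
`(∑ eᵢ* ⋆ ev_{eᵢ}) ⊗ (p ⊗ φ)`, and the linear form on `P ⊗ P*` in it is the evaluation. -/
theorem sum_antipode_mul (P : ProfMod A U) {ι : Type*} [Fintype ι] (e : ι → P)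
    (e' : ι → Module.Dual A P) (he : ∀ x, ∑ i, e' i x • e i = x) (φ : Module.Dual A P) (p : P) :
    ∑ i, antipode A U (mk P φ (e i)) * mk P (e' i) p = tgt A U (φ p) := by
  have h : ∀ i, antipode A U (mk P φ (e i)) * mk P (e' i) p =
      mk (P ⊗ dual P) (star (e' i) (evalAt P (e i))) (tmul p (toDual P φ)) := fun i => by
    rw [antipode_mk, dualMk, mk_mul_mk]
  rw [Finset.sum_congr rfl fun i _ => h i, ← mk_sum_left]
  refine mk_eq_mk (ev P) (Q := 𝟙_ (ProfMod A U)) rfl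
    (TensorProduct.ext' fun x (ψ : Module.Dual A P) => ?_)
  have h₁ : ∑ i, e' i x * ψ (e i) = ψ x := by
    conv_rhs => rw [← he x, map_sum]
    simp
  refine (one_mul (ψ x)).trans (h₁.symm.trans ?_)
  exact (LinearMap.sum_apply Finset.univ (fun i => star (e' i) (evalAt P (e i)))
    (tmul x (toDual P ψ))).symm

/-- `∑ (φ ⊗ eᵢ) S(eᵢ* ⊗ p) = s(φ(p))`, from `sum_antipode_mul` for the dual module and the
involutivity of the antipode. -/
theorem sum_mul_antipode (P : ProfMod A U) {ι : Type*} [Fintype ι] (e : ι → P)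
    (e' : ι → Module.Dual A P) (he : ∀ x, ∑ i, e' i x • e i = x) (φ : Module.Dual A P) (p : P) :
    ∑ i, mk P φ (e i) * antipode A U (mk P (e' i) p) = src A U (φ p) := by
  have hd' : ∀ ψ : Module.Dual A P, ∑ i, ψ (e i) • e' i = ψ := fun ψ => by
    ext x
    conv_rhs => rw [← he x, map_sum]
    simp [mul_comm]
  have hd : ∀ ψ : dual P, ∑ i, evalAt P (e i) ψ • toDual P (e' i) = ψ := hd'
  have h := sum_antipode_mul (dual P) (fun i => (toDual P (e' i))) (fun i => evalAt P (e i))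
    hd (evalAt P p) (toDual P φ)
  have h' : ∀ i, antipode A U (mk (dual P) (evalAt P p) (toDual P (e' i))) *
      mk (dual P) (evalAt P (e i)) (toDual P φ) =
      antipode A U (mk P φ (e i) * antipode A U (mk P (e' i) p)) := fun i => by
    rw [map_mul, mul_comm, antipode_mk P φ, antipode_mk P (e' i)]
    rfl
  rw [Finset.sum_congr rfl fun i _ => h' i, ← map_sum] at h
  rw [← antipode_antipode (∑ i, mk P φ (e i) * antipode A U (mk P (e' i) p)), h]
  exact antipode_tgt (φ p)

variable (K : Type*) [CommRing K] [Algebra K A] [Algebra K U] [IsScalarTower K A U]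

variable (A U) in
/-- The finite dual of a cocommutative right Hopf algebroid as a commutative Hopf algebroid over
`T_A`. -/
def hopfAlgebroid : CommHopfAlgebroid (unitEnd K A U) A (FinDual A U) where
  toCommBialgebroidData := bialgebroid A U K
  coassoc := coassoc_of_isFinDual (isFinDual_bialgebroid K)
  counit_left := counit_left_of_isFinDual (isFinDual_bialgebroid K)
  counit_right := counit_right_of_isFinDual (isFinDual_bialgebroid K)
  antipode := antipode A U
  antipode_s := antipode_src
  antipode_t := antipode_tgt
  antipode_left h := by
    induction h using induction_on with
    | zero => simp
    | add x y hx hy => simp only [map_add, hx, hy]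
    | mk P φ p =>
      obtain ⟨n, e, e', he⟩ := exists_dualBasis A P
      refine (pair_comul (isFinDual_bialgebroid K) _ _ _ P e e' he φ p).trans ?_
      rw [(isFinDual_bialgebroid K).counit, (isFinDual_bialgebroid K).target]
      exact sum_antipode_mul P e e' he φ p
  antipode_right h := by
    induction h using induction_on with
    | zero => simp
    | add x y hx hy => simp only [map_add, hx, hy]
    | mk P φ p =>
      obtain ⟨n, e, e', he⟩ := exists_dualBasis A P
      refine (pair_comul (isFinDual_bialgebroid K) _ _ _ P e e' he φ p).trans ?_
      rw [(isFinDual_bialgebroid K).counit, (isFinDual_bialgebroid K).source]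
      exact sum_mul_antipode P e e' he φ p

end Antipode

end FinDual

/-! ### The functor `χ` is strict monoidal and symmetric -/

/-- If the carriers of `P` and `Q` agree definitionally, this says that the underlying map of
`eqToHom h` is the identity. -/
theorem ProfMod.lin_eqToHom_heq {A : Type u} {U : Type v} [CommRing A] [Ring U] [Module A U]
    [ARing A U] {P Q : ProfMod A U} (h : P = Q) (x : P) :
    HEq (ProfMod.Hom.lin (eqToHom h) x) x := by
  subst h
  rfl

theorem ProfComod.lin_eqToHom_heq {R : Type*} {A : Type u} {H : Type*} [CommRing R] [CommRing A]
    [Algebra R A] [CommRing H] [Algebra R H] {C : CommBialgebroidData R A H} {M N : ProfComod C}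
    (h : M = N) (x : M) : HEq (ProfComod.Hom.lin (eqToHom h) x) x := by
  subst h
  rfl

/-- Two comodules with the same underlying `A`-module and the same coaction are equal. -/
theorem ProfComod.eq_of_coact {R : Type*} {A : Type u} {H : Type*} [CommRing R] [CommRing A]
    [Algebra R A] [CommRing H] [Algebra R H] {C : CommBialgebroidData R A H} (M : ProfComod C)
    (c : M →+ M ⊗[A] C.Src) (h₁ h₂ h₃) (h : M.coact = c) :
    M = { carrier := M, coact := c, coact_smul := h₁, coassoc := h₂, counit := h₃ } := by
  subst h
  rfl

theorem rTensor_refl {A B : Type*} [CommRing A] [CommRing B] [Algebra A B] (M : Type*)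
    [AddCommGroup M] [Module A M] (w : M ⊗[A] B) :
    (LinearEquiv.refl A M).toLinearMap.rTensor B w = w := by
  rw [LinearEquiv.refl_toLinearMap, LinearMap.rTensor_id, LinearMap.id_apply]

section Chi

variable {K : Type*} {A : Type u} {U : Type v} [CommRing K] [CommRing A] [Ring U] [Algebra K A]
  [Algebra K U] [Module A U] [IsScalarTower K A U] [Coalgebra A U] [CocommRightBialgebroid A U]
  {C : CommBialgebroidData (unitEnd K A U) A (FinDual A U)}

theorem chiCoact_of_dualBasis (hC : IsFinDual C) (P : ProfMod A U) {ι : Type*} [Fintype ι]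
    (e : ι → P) (e' : ι → Module.Dual A P) (he : ∀ x, ∑ i, e' i x • e i = x) (p : P) :
    chiCoact C P p = ∑ i, e i ⊗ₜ C.toSrc (FinDual.mk P (e' i) p) := by
  let f := (Fintype.equivFin ι).symm
  rw [chiCoact_eq hC P (e ∘ f) (e' ∘ f) (fun x => (f.sum_comp fun i => e' i x • e i).trans (he x)),
    preCoact_apply]
  exact f.sum_comp fun i => e i ⊗ₜ[A] C.toSrc (FinDual.mk P (e' i) p)

theorem unitCoact_chi (hC : IsFinDual C) :
    ProfComod.unitCoact C = (chiCoact C (𝟙_ (ProfMod A U)) : A →+ A ⊗[A] C.Src) := by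
  refine AddMonoidHom.ext fun a : A => ?_
  refine Eq.trans ?_ (chiCoact_of_dualBasis hC (𝟙_ (ProfMod A U)) (ι := Unit) (fun _ => (1 : A))
    (fun _ => (LinearMap.mulLeft A 1 : Module.Dual A A)) (fun x : A => ?_) a).symm
  · refine Eq.trans ?_ (Fintype.sum_unique _).symm
    exact congrArg (fun h => (1 : A) ⊗ₜ[A] C.toSrc h) (hC.target a)
  · rw [Fintype.sum_unique]
    change (1 * x) * 1 = x
    rw [mul_one, one_mul]

theorem chi_unit_eq (hC : IsFinDual C) : 𝟙_ (ProfComod C) = (chi C hC).obj (𝟙_ (ProfMod A U)) :=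
  ProfComod.eq_of_coact (𝟙_ (ProfComod C)) (chiCoact C (𝟙_ (ProfMod A U))) _ _ _ (unitCoact_chi hC)

theorem tensorCoact_chi (hC : IsFinDual C) (P Q : ProfMod A U) (z : P ⊗[A] Q) :
    ProfComod.tensorCoact ((chi C hC).obj P) ((chi C hC).obj Q) z =
      chiCoact C (P ⊗ Q : ProfMod A U) z := by
  obtain ⟨n, e, e', he⟩ := exists_dualBasis A P
  obtain ⟨m, d, d', hd⟩ := exists_dualBasis A Q
  refine addHom_congr (ProfComod.tensorCoact ((chi C hC).obj P) ((chi C hC).obj Q))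
    (chiCoact C (P ⊗ Q : ProfMod A U)) (fun (p : P) (q : Q) => ?_) z
  refine Eq.trans ?_ (chiCoact_of_dualBasis hC (P ⊗ Q)
    (fun k : Fin n × Fin m => FinDual.tmul (e k.1) (d k.2))
    (fun k => FinDual.star (e' k.1) (d' k.2)) (FinDual.tensor_dualBasis he hd) _).symm
  change ProfComod.diag A P Q C.Src (chiCoact C P p) (chiCoact C Q q) = _
  rw [chiCoact_of_dualBasis hC P e e' he, chiCoact_of_dualBasis hC Q d d' hd, map_sum]
  refine Eq.trans ?_ (Fintype.sum_prod_type_right _).symm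
  refine Finset.sum_congr rfl fun j _ => ?_
  rw [map_sum, LinearMap.sum_apply]
  refine Finset.sum_congr rfl fun i _ => ?_
  -- the product in `U°` reverses the order of the tensor factors, so commutativity is needed
  rw [ProfComod.diag_tmul, ← map_mul, mul_comm]
  exact congrArg (fun h => (e i ⊗ₜ[A] d j) ⊗ₜ[A] C.toSrc h)
    (FinDual.mk_mul_mk Q P (d' j) q (e' i) p)

theorem chi_tensor_eq (hC : IsFinDual C) (P Q : ProfMod A U) :
    (chi C hC).obj P ⊗ (chi C hC).obj Q = (chi C hC).obj (P ⊗ Q) :=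
  ProfComod.eq_of_coact ((chi C hC).obj P ⊗ (chi C hC).obj Q) (chiCoact C (P ⊗ Q : ProfMod A U))
    _ _ _ (AddMonoidHom.ext (tensorCoact_chi hC P Q))

/-- The identity of `A` as an isomorphism from the unit comodule. -/
def chiUnitIso (hC : IsFinDual C) : 𝟙_ (ProfComod C) ≅ (chi C hC).obj (𝟙_ (ProfMod A U)) :=
  ProfComod.isoMk (M := 𝟙_ (ProfComod C)) (N := (chi C hC).obj (𝟙_ (ProfMod A U)))
    (LinearEquiv.refl A A) (fun a : A =>
      (rTensor_refl A _).trans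
        (DFunLike.congr_fun (unitCoact_chi hC) a))

/-- The identity of `P ⊗ Q` as an isomorphism of comodules. -/
def chiTensorIso (hC : IsFinDual C) (P Q : ProfMod A U) :
    (chi C hC).obj P ⊗ (chi C hC).obj Q ≅ (chi C hC).obj (P ⊗ Q) :=
  ProfComod.isoMk (M := (chi C hC).obj P ⊗ (chi C hC).obj Q) (N := (chi C hC).obj (P ⊗ Q))
    (LinearEquiv.refl A (P ⊗[A] Q)) (fun z =>
      (rTensor_refl (P ⊗[A] Q) _).trans
        (tensorCoact_chi hC P Q z))

/-- The monoidal structure of `χ`, given by identity maps. -/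
def chiCore (hC : IsFinDual C) : (chi C hC).CoreMonoidal where
  εIso := chiUnitIso hC
  μIso := chiTensorIso hC
  μIso_hom_natural_left _ _ := ProfComod.hom_ext (TensorProduct.ext' fun _ _ => rfl)
  μIso_hom_natural_right _ _ := ProfComod.hom_ext (TensorProduct.ext' fun _ _ => rfl)
  associativity _ _ _ := ProfComod.hom_ext (TensorProduct.ext_threefold fun _ _ _ => rfl)
  left_unitality _ := ProfComod.hom_ext (TensorProduct.ext' fun _ _ => rfl)
  right_unitality _ := ProfComod.hom_ext (TensorProduct.ext' fun _ _ => rfl)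

/-- The functor `χ` as a braided monoidal functor. -/
@[reducible]
def chiBraided (hC : IsFinDual C) : (chi C hC).Braided :=
  { (chiCore hC).toMonoidal with
    braided := fun _ _ => ProfComod.hom_ext (TensorProduct.ext' fun _ _ => rfl) }

theorem isStrictMonoidal_chi (hC : IsFinDual C) :
    letI := chiBraided hC
    IsStrictMonoidal (chi C hC) :=
  letI := chiBraided hC
  { unit_eq := chi_unit_eq hC
    ε_eq := ProfComod.hom_ext (LinearMap.ext fun a =>
      (eq_of_heq (ProfComod.lin_eqToHom_heq (chi_unit_eq hC) a)).symm)
    tensor_eq := chi_tensor_eq hC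
    μ_eq := fun P Q => ProfComod.hom_ext (LinearMap.ext fun z =>
      (eq_of_heq (ProfComod.lin_eqToHom_heq (chi_tensor_eq hC P Q) z)).symm) }

end Chi

/-! ### The inverse of `χ` -/

/-- Two right `U`-modules with the same underlying `A`-module and the same action are equal. -/
theorem ProfMod.eq_of_smul {A : Type u} {U : Type v} [CommRing A] [Ring U] [Module A U]
    [ARing A U] (P : ProfMod A U) (m : Module Uᵐᵒᵖ P) (h₁)
    (h : ∀ (u : Uᵐᵒᵖ) (p : P), m.toSMul.smul u p = P.rightModule.toSMul.smul u p) :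
    ({ carrier := P, rightModule := m, op_s_smul := h₁ } : ProfMod A U) = P := by
  obtain rfl : m = P.rightModule := Module.ext' _ _ h
  rfl

theorem ProfMod.op_smul_of_eq {A : Type u} {U : Type v} [CommRing A] [Ring U] [Module A U]
    [ARing A U] {P Q : ProfMod A U} (h : P = Q) (u : U) {x : P} {y z : Q}
    (hy : ProfMod.Hom.lin (eqToHom h) x = y)
    (hz : ProfMod.Hom.lin (eqToHom h) (MulOpposite.op u • x) = z) : z = MulOpposite.op u • y := by
  rw [← hy, ← hz, ProfMod.lin_op_smul]

theorem ProfMod.hom_heq {A : Type u} {U : Type v} [CommRing A] [Ring U] [Module A U] [ARing A U]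
    {P Q P' Q' : ProfMod A U} (hP : P = P') (hQ : Q = Q') {f : P ⟶ Q} {g : P' ⟶ Q'}
    (h : HEq (ProfMod.Hom.lin f) (ProfMod.Hom.lin g)) : HEq f g := by
  subst hP hQ
  exact heq_of_eq (ProfMod.hom_ext (eq_of_heq h))

theorem ProfComod.hom_heq {R : Type*} {A : Type u} {H : Type*} [CommRing R] [CommRing A]
    [Algebra R A] [CommRing H] [Algebra R H] {C : CommBialgebroidData R A H}
    {M N M' N' : ProfComod C} (hM : M = M') (hN : N = N') {f : M ⟶ N} {g : M' ⟶ N'}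
    (h : HEq (ProfComod.Hom.lin f) (ProfComod.Hom.lin g)) : HEq f g := by
  subst hM hN
  exact heq_of_eq (ProfComod.hom_ext (eq_of_heq h))

section Inverse

variable {K : Type*} {A : Type u} {U : Type v} [CommRing K] [CommRing A] [Ring U] [Algebra K A]
  [Algebra K U] [Module A U] [IsScalarTower K A U] [Coalgebra A U] [CocommRightBialgebroid A U]
  {C : CommBialgebroidData (unitEnd K A U) A (FinDual A U)}

theorem FinDual.zeta_src_mul (a : A) (h : FinDual A U) (u : U) :
    zeta A U (src A U a * h) u = a * zeta A U h u := by
  induction h using induction_on with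
  | zero => simp
  | add x y hx hy => simp only [mul_add, map_add, LinearMap.add_apply, hx, hy]
  | mk P φ p => rw [src_mul_mk, zeta_mk, zeta_mk]; rfl

theorem FinDual.zeta_tgt_mul (a : A) (h : FinDual A U) (u : U) :
    zeta A U (tgt A U a * h) u = zeta A U h (ARing.s a * u) := by
  induction h using induction_on with
  | zero => simp
  | add x y hx hy => simp only [mul_add, map_add, LinearMap.add_apply, hx, hy]
  | mk P φ p =>
    rw [tgt_mul_mk, zeta_mk, zeta_mk, MulOpposite.op_mul, mul_smul, ProfMod.op_s_smul]

/-- The map `h ↦ ζ(h)(u)`, linear for the left `A`-action. -/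
def zetaAt (hC : IsFinDual C) (u : U) : C.Src →ₗ[A] A where
  toFun h := FinDual.zeta A U h u
  map_add' h h' := by
    change FinDual.zeta A U ((show FinDual A U from h) + (show FinDual A U from h')) u = _
    rw [map_add]
    rfl
  map_smul' a h := by
    change FinDual.zeta A U (C.s a * (show FinDual A U from h)) u = _
    rw [hC.source, FinDual.zeta_src_mul]
    rfl

theorem zetaAt_mulSrc (hC : IsFinDual C) (a : A) (u : U) :
    zetaAt hC u ∘ₗ C.mulSrc (C.t a) = zetaAt hC (ARing.s a * u) := by
  refine LinearMap.ext fun h : FinDual A U => ?_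
  change FinDual.zeta A U (C.t a * h) u = _
  rw [hC.target, FinDual.zeta_tgt_mul]
  rfl

theorem zetaAt_one (hC : IsFinDual C) : zetaAt hC (1 : U) = C.counitLin := by
  refine LinearMap.ext fun h : FinDual A U => ?_
  change FinDual.zeta A U h 1 = C.counit h
  induction h using FinDual.induction_on with
  | zero => simp
  | add x y hx hy => simp only [map_add, LinearMap.add_apply, hx, hy]
  | mk P φ p => rw [FinDual.zeta_mk, hC.counit, MulOpposite.op_one, one_smul]

theorem zetaAt_add (hC : IsFinDual C) (u v : U) :
    zetaAt hC (u + v) = zetaAt hC u + zetaAt hC v :=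
  LinearMap.ext fun h : FinDual A U => map_add (FinDual.zeta A U h) u v

theorem zetaAt_zero (hC : IsFinDual C) : zetaAt hC (0 : U) = 0 :=
  LinearMap.ext fun h : FinDual A U => map_zero (FinDual.zeta A U h)

/-- The map `x ⊗ y ↦ ζ(x)(s(ζ(y)(u)) v)`; its composition with the comultiplication is
`h ↦ ζ(h)(u v)`. -/
def zetaSqAt (hC : IsFinDual C) (u v : U) : C.SrcSq →ₗ[A] A :=
  let b : C.Tgt ⊗[A] C.Src →+ A := TensorProduct.liftAddHom
    (AddMonoidHom.mk' (fun x : C.Tgt => AddMonoidHom.mk'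
        (fun y : C.Src => FinDual.zeta A U x (ARing.s (zetaAt hC u y) * v))
        (fun y y' => by rw [map_add, map_add, add_mul, map_add]))
      (fun x x' => by
        ext y
        change FinDual.zeta A U ((show FinDual A U from x) + (show FinDual A U from x')) _ = _
        rw [map_add]
        rfl))
    (fun a x y => by
      change FinDual.zeta A U (C.t a * (show FinDual A U from x)) (ARing.s (zetaAt hC u y) * v) =
        FinDual.zeta A U x (ARing.s (zetaAt hC u (a • y)) * v)
      rw [hC.target, FinDual.zeta_tgt_mul, map_smul, smul_eq_mul, map_mul ARing.s, mul_assoc])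
  { toFun := b
    map_add' := map_add b
    map_smul' := fun a z => by
      refine addHom_congr (b.comp (AddMonoidHom.mulLeft (C.srcSq a)))
        ((AddMonoidHom.mulLeft a).comp b) (fun (x : FinDual A U) y => ?_) z
      change b ((C.toTgt (C.s a) ⊗ₜ[A] (1 : C.Src)) * (C.toTgt x ⊗ₜ[A] y)) = _
      rw [Algebra.TensorProduct.tmul_mul_tmul, one_mul]
      change FinDual.zeta A U (C.s a * x) (ARing.s (zetaAt hC u y) * v) = _
      rw [hC.source, FinDual.zeta_src_mul]
      rfl }

theorem zetaSqAt_append (hC : IsFinDual C) (u v : U) (h : FinDual A U) :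
    zetaSqAt hC u v ∘ₗ C.append h = zetaAt hC (ARing.s (FinDual.zeta A U h u) * v) := rfl

theorem zetaSqAt_comul (hC : IsFinDual C) (u v : U) :
    zetaSqAt hC u v ∘ₗ C.comulLin = zetaAt hC (u * v) := by
  refine LinearMap.ext fun h : FinDual A U => ?_
  induction h using FinDual.induction_on with
  | zero => exact (map_zero (zetaSqAt hC u v ∘ₗ C.comulLin)).trans (map_zero (zetaAt hC _)).symm
  | add x y hx hy =>
    exact (map_add (zetaSqAt hC u v ∘ₗ C.comulLin) _ _).trans
      ((congrArg₂ (· + ·) hx hy).trans (map_add (zetaAt hC _) _ _).symm)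
  | mk P φ p =>
    obtain ⟨n, e, e', he⟩ := exists_dualBasis A P
    change zetaSqAt hC u v (C.comul (FinDual.mk P φ p)) = FinDual.zeta A U (FinDual.mk P φ p) _
    refine (congrArg (zetaSqAt hC u v) (hC.comul P φ p n e e' he)).trans ?_
    refine (map_sum (zetaSqAt hC u v) _ _).trans ?_
    have h₁ : ∀ i, FinDual.zeta A U (FinDual.mk P φ (e i))
        (ARing.s (FinDual.zeta A U (FinDual.mk P (e' i) p) u) * v) =
        φ (MulOpposite.op v • (e' i (MulOpposite.op u • p) • e i)) := fun i => by
      rw [FinDual.zeta_mk, FinDual.zeta_mk, MulOpposite.op_mul, mul_smul, ProfMod.op_s_smul]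
    refine (Finset.sum_congr rfl fun i _ => h₁ i).trans ?_
    rw [← map_sum, ← Finset.smul_sum, he, FinDual.zeta_mk, MulOpposite.op_mul, mul_smul]

section Eval

variable {M N : Type*} [AddCommGroup M] [Module A M] [AddCommGroup N] [Module A N]

/-- The map `m ⊗ h ↦ ζ(h)(u) m`. -/
def evalZeta (hC : IsFinDual C) (M : Type*) [AddCommGroup M] [Module A M] (u : U) :
    M ⊗[A] C.Src →ₗ[A] M :=
  (TensorProduct.rid A M).toLinearMap ∘ₗ (zetaAt hC u).lTensor M

theorem evalZeta_tmul (hC : IsFinDual C) (u : U) (m : M) (h : FinDual A U) :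
    evalZeta hC M u (m ⊗ₜ C.toSrc h) = FinDual.zeta A U h u • m := by
  refine (TensorProduct.rid_tmul _ _).trans ?_
  rfl

theorem evalZeta_rTensor (hC : IsFinDual C) (u : U) (f : M →ₗ[A] N) (z : M ⊗[A] C.Src) :
    evalZeta hC N u (f.rTensor C.Src z) = f (evalZeta hC M u z) := by
  induction z with
  | zero => simp
  | add z z' h h' => simp only [map_add, h, h']
  | tmul m h =>
    rw [LinearMap.rTensor_tmul]
    refine (evalZeta_tmul hC u (f m) h).trans ?_
    refine Eq.trans ?_ (congrArg f (evalZeta_tmul hC u m h)).symm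
    rw [map_smul]

theorem evalZeta_mulSrc (hC : IsFinDual C) (a : A) (u : U) (z : M ⊗[A] C.Src) :
    evalZeta hC M u ((C.mulSrc (C.t a)).lTensor M z) = evalZeta hC M (ARing.s a * u) z := by
  simp only [evalZeta, LinearMap.comp_apply]
  rw [← LinearMap.comp_apply (LinearMap.lTensor M _), ← LinearMap.lTensor_comp, zetaAt_mulSrc]

theorem evalZeta_add (hC : IsFinDual C) (u v : U) (z : M ⊗[A] C.Src) :
    evalZeta hC M (u + v) z = evalZeta hC M u z + evalZeta hC M v z := by
  simp only [evalZeta, LinearMap.comp_apply, zetaAt_add, LinearMap.lTensor_add,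
    LinearMap.add_apply, map_add]

theorem evalZeta_zero (hC : IsFinDual C) (z : M ⊗[A] C.Src) : evalZeta hC M (0 : U) z = 0 := by
  simp only [evalZeta, LinearMap.comp_apply, zetaAt_zero, LinearMap.lTensor_zero,
    LinearMap.zero_apply, map_zero]

/-- If `ζ` is injective and `M` is finitely generated and projective, then the elements of
`M ⊗_A U°` are determined by their evaluations in `M` at all `u ∈ U`. -/
theorem ext_of_evalZeta [Module.Finite A M] [Module.Projective A M] (hC : IsFinDual C)
    (hζ : Function.Injective (FinDual.zeta A U)) {z z' : M ⊗[A] C.Src}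
    (h : ∀ u : U, evalZeta hC M u z = evalZeta hC M u z') : z = z' := by
  obtain ⟨n, e, e', he⟩ := exists_dualBasis A M
  -- the components of `z` with respect to the dual basis
  let c (i : Fin n) : M ⊗[A] C.Src →ₗ[A] C.Src :=
    (TensorProduct.lid A C.Src).toLinearMap ∘ₗ (e' i).rTensor C.Src
  have hc : ∀ w, ∑ i, e i ⊗ₜ[A] c i w = w := fun w => by
    induction w with
    | zero => simp
    | add w w' h h' => simp only [map_add, TensorProduct.tmul_add, Finset.sum_add_distrib, h, h']
    | tmul m k =>
      conv_rhs => rw [← he m, TensorProduct.sum_tmul]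
      refine Finset.sum_congr rfl fun i _ => ?_
      rw [TensorProduct.smul_tmul]
      rfl
  have hc' : ∀ i u w, zetaAt hC u (c i w) = e' i (evalZeta hC M u w) := fun i u w => by
    induction w with
    | zero => simp
    | add w w' h h' => simp only [map_add, h, h']
    | tmul m k =>
      refine Eq.trans ?_ (congrArg (e' i) (evalZeta_tmul hC u m k)).symm
      refine ((zetaAt hC u).map_smul (e' i m) k).trans ?_
      rw [map_smul, smul_eq_mul, smul_eq_mul, mul_comm]
      rfl
  have key : ∀ i, c i z = c i z' := fun i => hζ (LinearMap.ext fun u =>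
    (hc' i u z).trans ((congrArg (e' i) (h u)).trans (hc' i u z').symm))
  rw [← hc z, ← hc z']
  simp only [key]

end Eval

namespace ProfComod

variable (M : ProfComod C)

/-- The action `m u = ζ(m₁)(u) m₀` on a comodule. -/
def act (hC : IsFinDual C) (u : U) : M →+ M := (evalZeta hC M u).toAddMonoidHom.comp M.coact

theorem act_apply (hC : IsFinDual C) (u : U) (m : M) :
    M.act hC u m = evalZeta hC M u (M.coact m) := rfl

theorem act_one (hC : IsFinDual C) (m : M) : M.act hC 1 m = m := by
  refine Eq.trans ?_ (M.counit m)
  rw [act_apply, evalZeta, zetaAt_one]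
  rfl

theorem act_smul (hC : IsFinDual C) (a : A) (u : U) (m : M) :
    M.act hC u (a • m) = M.act hC (ARing.s a * u) m := by
  rw [act_apply, act_apply, M.coact_smul, evalZeta_mulSrc]

theorem act_mul (hC : IsFinDual C) (u v : U) (m : M) :
    M.act hC (u * v) m = M.act hC v (M.act hC u m) := by
  have h : ∀ w : M ⊗[A] C.Src,
      TensorProduct.rid A M ((zetaSqAt hC u v).lTensor M (C.coactTensor M.coact M.coact_smul w)) =
        M.act hC v (evalZeta hC M u w) := fun w => by
    induction w with
    | zero => simp
    | add w w' h h' => simp only [map_add, h, h']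
    | tmul m k =>
      change FinDual A U at k
      refine Eq.trans ?_ (congrArg (M.act hC v) (evalZeta_tmul hC u m k)).symm
      rw [act_smul]
      change TensorProduct.rid A M ((zetaSqAt hC u v).lTensor M
        ((C.append k).lTensor M (M.coact m))) = _
      rw [← LinearMap.comp_apply, ← LinearMap.lTensor_comp, zetaSqAt_append]
      rfl
  rw [act_apply M hC u, ← h, act_apply, ← M.coassoc, ← LinearMap.comp_apply (LinearMap.lTensor _ _),
    ← LinearMap.lTensor_comp, zetaSqAt_comul]
  rfl

theorem act_s (hC : IsFinDual C) (a : A) (m : M) : M.act hC (ARing.s a) m = a • m := by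
  rw [← mul_one (ARing.s a : U), ← act_smul, act_one]

end ProfComod

/-- The right `U`-action `m u = ζ(m₁)(u) m₀`. -/
abbrev chiInvModule (hC : IsFinDual C) (M : ProfComod C) : Module Uᵐᵒᵖ M where
  smul u m := M.act hC u.unop m
  one_smul := M.act_one hC
  mul_smul u v m := M.act_mul hC v.unop u.unop m
  smul_zero u := map_zero (M.act hC u.unop)
  smul_add u := map_add (M.act hC u.unop)
  add_smul u v m := evalZeta_add hC u.unop v.unop (M.coact m)
  zero_smul m := evalZeta_zero hC (M.coact m)

/-- The right `U`-module of a comodule. -/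
def chiInvObj (hC : IsFinDual C) (M : ProfComod C) : ProfMod A U where
  carrier := M
  rightModule := chiInvModule hC M
  op_s_smul := M.act_s hC

/-- The functor from comodules to modules given by the action `m u = ζ(m₁)(u) m₀`. -/
def chiInv (hC : IsFinDual C) : ProfComod C ⥤ ProfMod A U where
  obj := chiInvObj hC
  map {M N} f :=
    { hom := ProfComod.Hom.lin f
      map_op_smul := fun u (m : M) => by
        refine (evalZeta_rTensor hC u (ProfComod.Hom.lin f) (M.coact m)).symm.trans ?_
        rw [ProfComod.lin_colinear]
        rfl }

theorem act_chi (hC : IsFinDual C) (P : ProfMod A U) (u : U) (p : P) :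
    ((chi C hC).obj P).act hC u p = MulOpposite.op u • p := by
  obtain ⟨n, e, e', he⟩ := exists_dualBasis A P
  change evalZeta hC P u (chiCoact C P p) = _
  rw [chiCoact_eq hC P e e' he, preCoact_apply, map_sum]
  simp only [evalZeta_tmul, FinDual.zeta_mk]
  exact he _

theorem chiInv_chi_obj (hC : IsFinDual C) (P : ProfMod A U) :
    (chiInv hC).obj ((chi C hC).obj P) = P :=
  ProfMod.eq_of_smul P (chiInvModule hC ((chi C hC).obj P)) _ fun u p => act_chi hC P u.unop p

theorem chi_chiInv (hC : IsFinDual C) : chi C hC ⋙ chiInv hC = 𝟭 (ProfMod A U) :=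
  Functor.hext (chiInv_chi_obj hC) fun P Q _ =>
    ProfMod.hom_heq (chiInv_chi_obj hC P) (chiInv_chi_obj hC Q) HEq.rfl

theorem chiCoact_chiInv (hC : IsFinDual C) (hζ : Function.Injective (FinDual.zeta A U))
    (M : ProfComod C) (m : M) : M.coact m = chiCoact C ((chiInv hC).obj M) m :=
  ext_of_evalZeta hC hζ fun u => (act_chi hC ((chiInv hC).obj M) u m).symm

theorem chi_chiInv_obj (hC : IsFinDual C) (hζ : Function.Injective (FinDual.zeta A U))
    (M : ProfComod C) : (chi C hC).obj ((chiInv hC).obj M) = M :=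
  (ProfComod.eq_of_coact M (chiCoact C ((chiInv hC).obj M)) _ _ _
    (AddMonoidHom.ext (chiCoact_chiInv hC hζ M))).symm

theorem chiInv_chi (hC : IsFinDual C) (hζ : Function.Injective (FinDual.zeta A U)) :
    chiInv hC ⋙ chi C hC = 𝟭 (ProfComod C) :=
  Functor.hext (chi_chiInv_obj hC hζ) fun M N _ =>
    ProfComod.hom_heq (chi_chiInv_obj hC hζ M) (chi_chiInv_obj hC hζ N) HEq.rfl

theorem chiInv_unit_eq (hC : IsFinDual C) :
    𝟙_ (ProfMod A U) = (chiInv hC).obj (𝟙_ (ProfComod C)) := by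
  rw [chi_unit_eq hC, chiInv_chi_obj]

/-- Both sides are `G (χ (G M ⊗ G N))` for `G` the inverse functor, since `M = χ (G M)` and
`N = χ (G N)`. -/
theorem chiInv_tensor_eq (hC : IsFinDual C) (hζ : Function.Injective (FinDual.zeta A U))
    (M N : ProfComod C) :
    (chiInv hC).obj M ⊗ (chiInv hC).obj N = (chiInv hC).obj (M ⊗ N) := by
  conv_rhs => rw [← chi_chiInv_obj hC hζ M, ← chi_chiInv_obj hC hζ N, chi_tensor_eq, chiInv_chi_obj]

/-- The identity of `A` as an isomorphism from the unit module. -/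
def chiInvUnitIso (hC : IsFinDual C) : 𝟙_ (ProfMod A U) ≅ (chiInv hC).obj (𝟙_ (ProfComod C)) :=
  ProfMod.isoMk (P := 𝟙_ (ProfMod A U)) (Q := (chiInv hC).obj (𝟙_ (ProfComod C)))
    (LinearEquiv.refl A A) fun u _ => ProfMod.op_smul_of_eq (chiInv_unit_eq hC) u
      (eq_of_heq (ProfMod.lin_eqToHom_heq _ _)) (eq_of_heq (ProfMod.lin_eqToHom_heq _ _))

/-- The identity of `M ⊗ N` as an isomorphism of modules. -/
def chiInvTensorIso (hC : IsFinDual C) (hζ : Function.Injective (FinDual.zeta A U))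
    (M N : ProfComod C) :
    (chiInv hC).obj M ⊗ (chiInv hC).obj N ≅ (chiInv hC).obj (M ⊗ N) :=
  ProfMod.isoMk (P := (chiInv hC).obj M ⊗ (chiInv hC).obj N) (Q := (chiInv hC).obj (M ⊗ N))
    (LinearEquiv.refl A (M ⊗[A] N)) fun u _ => ProfMod.op_smul_of_eq (chiInv_tensor_eq hC hζ M N) u
      (eq_of_heq (ProfMod.lin_eqToHom_heq _ _)) (eq_of_heq (ProfMod.lin_eqToHom_heq _ _))

/-- The monoidal structure of the inverse functor, given by identity maps. -/
def chiInvCore (hC : IsFinDual C) (hζ : Function.Injective (FinDual.zeta A U)) :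
    (chiInv hC).CoreMonoidal where
  εIso := chiInvUnitIso hC
  μIso := chiInvTensorIso hC hζ
  μIso_hom_natural_left _ _ := ProfMod.hom_ext (TensorProduct.ext' fun _ _ => rfl)
  μIso_hom_natural_right _ _ := ProfMod.hom_ext (TensorProduct.ext' fun _ _ => rfl)
  associativity _ _ _ := ProfMod.hom_ext (TensorProduct.ext_threefold fun _ _ _ => rfl)
  left_unitality _ := ProfMod.hom_ext (TensorProduct.ext' fun _ _ => rfl)
  right_unitality _ := ProfMod.hom_ext (TensorProduct.ext' fun _ _ => rfl)

/-- The inverse functor as a braided monoidal functor. -/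
@[reducible]
def chiInvBraided (hC : IsFinDual C) (hζ : Function.Injective (FinDual.zeta A U)) :
    (chiInv hC).Braided :=
  { (chiInvCore hC hζ).toMonoidal with
    braided := fun _ _ => ProfMod.hom_ext (TensorProduct.ext' fun _ _ => rfl) }

theorem isStrictMonoidal_chiInv (hC : IsFinDual C) (hζ : Function.Injective (FinDual.zeta A U)) :
    letI := chiInvBraided hC hζ
    IsStrictMonoidal (chiInv hC) :=
  letI := chiInvBraided hC hζ
  { unit_eq := chiInv_unit_eq hC
    ε_eq := ProfMod.hom_ext (LinearMap.ext fun a =>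
      (eq_of_heq (ProfMod.lin_eqToHom_heq (chiInv_unit_eq hC) a)).symm)
    tensor_eq := chiInv_tensor_eq hC hζ
    μ_eq := fun M N => ProfMod.hom_ext (LinearMap.ext fun z =>
      (eq_of_heq (ProfMod.lin_eqToHom_heq (chiInv_tensor_eq hC hζ M N) z)).symm) }

end Inverse

end HopfDual

end

theorem theorem4p6 {K A U : Type*} [CommRing K] [CommRing A]
    [Algebra K A] [Ring U] [Algebra K U] [Module A U] [IsScalarTower K A U] [Coalgebra A U]
    [CocommRightHopfAlgebroid A U] :
    ∃ (H : CommHopfAlgebroid (unitEnd K A U) A (FinDual A U))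
      (hH : IsFinDual H.toCommBialgebroidData),
      (∃ _ : (chi H.toCommBialgebroidData hH).Braided,
        IsStrictMonoidal (chi H.toCommBialgebroidData hH)) ∧
      (Function.Injective (FinDual.zeta A U) →
        ∃ (G : ProfComod H.toCommBialgebroidData ⥤ ProfMod A U) (_ : G.Braided),
          IsStrictMonoidal G ∧ chi H.toCommBialgebroidData hH ⋙ G = 𝟭 (ProfMod A U) ∧
          G ⋙ chi H.toCommBialgebroidData hH = 𝟭 (ProfComod H.toCommBialgebroidData)) := by
  have hC := FinDual.isFinDual_bialgebroid (A := A) (U := U) K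
  exact ⟨FinDual.hopfAlgebroid A U K, hC, ⟨chiBraided hC, isStrictMonoidal_chi hC⟩, fun hζ =>
    ⟨chiInv hC, chiInvBraided hC hζ, isStrictMonoidal_chiInv hC hζ, chi_chiInv hC,
      chiInv_chi hC hζ⟩⟩
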